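/- Operator spaces are complex and given by matrix norms on all $M_n(V)$ satisfying Ruan's axioms (completeness is not required). The dual $V^*$ carries the norms $M_n(V^*)=\mathcal{CB}(V,M_n)$, the bidual is $V^{**}=(V^*)^*$, and $\mathcal T_n=M_n^*$ denotes the operator space of trace-class operators on $\mathbb C^n$. Subspaces carry the inherited matrix norms and quotients the quotient matrix norms. For operator spaces $E,F$ put $d_{cb}(E,F)=\inf\|\theta\|_{cb}\|\theta^{-1}\|_{cb}$, the infimum being over all complete isomorphisms $\theta:E\to F$ (and $\infty$ if there are none). Let $\lambda\ge 0$ be a real number. A finite-dimensional operator space $E$ is *$\lambda$-coexact* if for every $\varepsilon>0$ there are $n$ and a subspace $X\subseteq\mathcal T_n$ with $d_{cb}(E,\mathcal T_n/X)<\lambda+\varepsilon$. An operator space $E$ is *$\lambda$-subcoexact* if every finite-dimensional subspace of $E$ is contained in a finite-dimensional $\lambda$-coexact subspace of $E$. An operator space $V$ is *locally reflexive with constant $\lambda$* if for every finite-dimensional operator space $W$, every complete contraction $\varphi:W\to V^{**}$ is the limit, in the point-weak* topology, of a net of linear maps $\varphi_\nu:W\to V$ with $\|\varphi_\nu\|_{cb}\le\lambda$;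 that is, $f(\varphi_\nu(x))\to\varphi(x)(f)$ for all $x\in W$ and $f\in V^*$. It is *locally reflexive* if this holds with $\lambda=1$, so that the $\varphi_\nu$ are complete contractions. **Proposition.** Let $V$ be an operator space. If $V^{**}$ is $1$-subcoexact, then $V$ is locally reflexive. More generally, for every $\lambda\ge 0$, if $V^{**}$ is $\lambda$-subcoexact, then $V$ is locally reflexive with constant $\lambda$. -/

import Mathlib

open scoped Matrix Matrix.Norms.L2Operator Kronecker NNReal ENNReal Topology
open Filter

universe u w

set_option linter.unusedSectionVars false

namespace OpSpace

section MatrixNormFacts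
variable {m n k l : Type*} [Fintype m] [Fintype n] [Fintype k] [Fintype l]
  [DecidableEq m] [DecidableEq n] [DecidableEq k] [DecidableEq l]

theorem norm_reindex (e : m ≃ n) (A : Matrix m m ℂ) :
    ‖Matrix.reindex e e A‖ = ‖A‖ := by
  let φ : Matrix m m ℂ →⋆ₙₐ[ℂ] Matrix n n ℂ :=
    { toFun := fun A => Matrix.reindex e e A
      map_smul' := fun c A => by ext; simp
      map_zero' := by ext; simp
      map_add' := fun A B => by ext; simp
      map_mul' := fun A B => by simp
      map_star' := fun A => by ext; simp [Matrix.star_eq_conjTranspose] }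
  exact NonUnitalStarAlgHom.norm_map φ (Matrix.reindex e e).injective A

theorem norm_fromBlocks_diag (A : Matrix m m ℂ) (B : Matrix n n ℂ) :
    ‖Matrix.fromBlocks A 0 0 B‖ = max ‖A‖ ‖B‖ := by
  let φ : (Matrix m m ℂ × Matrix n n ℂ) →⋆ₙₐ[ℂ] Matrix (m ⊕ n) (m ⊕ n) ℂ :=
    { toFun := fun A => Matrix.fromBlocks A.1 0 0 A.2
      map_smul' := fun c A => by simp [Matrix.fromBlocks_smul]
      map_zero' := by simp
      map_add' := fun A B => by simp [Matrix.fromBlocks_add]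
      map_mul' := fun A B => by simp [Matrix.fromBlocks_multiply]
      map_star' := fun A => by simp [Matrix.star_eq_conjTranspose, Matrix.fromBlocks_conjTranspose] }
  have hφ : Function.Injective φ := by
    intro A B h
    have h' : Matrix.fromBlocks A.1 0 0 A.2 = Matrix.fromBlocks B.1 0 0 B.2 := h
    rw [Matrix.fromBlocks_inj] at h'
    exact Prod.ext h'.1 h'.2.2.2
  exact NonUnitalStarAlgHom.norm_map φ hφ (A, B)

theorem norm_kronecker_one_le (A : Matrix m n ℂ) :
    ‖A ⊗ₖ (1 : Matrix k k ℂ)‖ ≤ ‖A‖ := by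
  let φ : Matrix n n ℂ →⋆ₙₐ[ℂ] Matrix (n × k) (n × k) ℂ :=
    { toFun := fun A => A ⊗ₖ (1 : Matrix k k ℂ)
      map_smul' := fun c A => by simp [Matrix.smul_kronecker]
      map_zero' := by simp
      map_add' := fun A B => by simp [Matrix.add_kronecker]
      map_mul' := fun A B => by simp [← Matrix.mul_kronecker_mul]
      map_star' := fun A => by
        simp [Matrix.star_eq_conjTranspose, Matrix.conjTranspose_kronecker] }
  have h1 : ‖φ (Aᴴ * A)‖ ≤ ‖Aᴴ * A‖ := NonUnitalStarAlgHom.norm_apply_le φ _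
  have h2 : φ (Aᴴ * A) = (A ⊗ₖ (1 : Matrix k k ℂ))ᴴ * (A ⊗ₖ (1 : Matrix k k ℂ)) := by
    change (Aᴴ * A) ⊗ₖ (1 : Matrix k k ℂ) = _
    simp [Matrix.conjTranspose_kronecker, ← Matrix.mul_kronecker_mul]
  rw [h2, Matrix.l2_opNorm_conjTranspose_mul_self, Matrix.l2_opNorm_conjTranspose_mul_self] at h1
  exact (mul_self_le_mul_self_iff (norm_nonneg _) (norm_nonneg _)).2 h1

theorem norm_colMatrix_le (v : EuclideanSpace ℂ m) :
    ‖(Matrix.of fun i (_ : Fin 1) => v i : Matrix m (Fin 1) ℂ)‖ ≤ ‖v‖ := by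
  rw [Matrix.l2_opNorm_def]
  refine ContinuousLinearMap.opNorm_le_bound _ (norm_nonneg _) fun c => le_of_eq ?_
  have h : ((Matrix.toEuclideanLin.trans LinearMap.toContinuousLinearMap)
      (Matrix.of fun i (_ : Fin 1) => v i : Matrix m (Fin 1) ℂ)) c = c 0 • v := by
    ext i
    simp [Matrix.mulVec, dotProduct, mul_comm]
  rw [h, norm_smul, mul_comm, EuclideanSpace.norm_eq c]
  simp

theorem norm_rowMatrix_le (v : EuclideanSpace ℂ m) :
    ‖(Matrix.of fun (_ : Fin 1) i => star (v i) : Matrix (Fin 1) m ℂ)‖ ≤ ‖v‖ := by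
  rw [← Matrix.l2_opNorm_conjTranspose]
  convert norm_colMatrix_le v using 2
  ext i j
  simp

theorem norm_le_of_sesq (A : Matrix m n ℂ) (C : ℝ)
    (hC : ∀ (ξ : EuclideanSpace ℂ m) (η : EuclideanSpace ℂ n),
      ‖∑ i, ∑ j, (star (ξ i) * η j) • A i j‖ ≤ C * ‖ξ‖ * ‖η‖) (h0 : 0 ≤ C) : ‖A‖ ≤ C := by
  rw [Matrix.l2_opNorm_def]
  refine ContinuousLinearMap.opNorm_le_bound _ h0 fun η => ?_
  set y := ((Matrix.toEuclideanLin.trans LinearMap.toContinuousLinearMap) A) η with hy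
  have hyi : ∀ i, y i = ∑ j, A i j * η j := fun i => by
    simp [hy, Matrix.mulVec, dotProduct]
  have h := hC y η
  have h2 : ∑ i, ∑ j, (star (y i) * η j) • A i j = ((‖y‖ : ℂ)) ^ 2 := by
    refine Eq.trans ?_ (inner_self_eq_norm_sq_to_K (𝕜 := ℂ) y)
    rw [PiLp.inner_apply]
    refine Finset.sum_congr rfl fun i _ => ?_
    conv_rhs => rw [RCLike.inner_apply]
    nth_rw 2 [hyi i]
    rw [Finset.sum_mul]
    refine Finset.sum_congr rfl fun j _ => ?_
    simp; ring
  rw [h2] at h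
  simp only [norm_pow, Complex.norm_real, norm_norm] at h
  rcases eq_or_lt_of_le (norm_nonneg y) with h3 | h3
  · rw [← h3]; positivity
  · nlinarith

theorem norm_entry_le (A : Matrix m n ℂ) (i : m) (j : n) : ‖A i j‖ ≤ ‖A‖ := by
  have h := Matrix.l2_opNorm_mulVec A (EuclideanSpace.single j 1)
  have h2 := PiLp.norm_apply_le ((EuclideanSpace.equiv m ℂ).symm
    (A *ᵥ (EuclideanSpace.single j (1 : ℂ)).ofLp)) i
  simp at h h2
  exact h2.trans h

end MatrixNormFacts

section MatrixOps
variable {V : Type*} [AddCommGroup V] [Module ℂ V]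

/-- The product `α v β` of a scalar matrix, a matrix over `V` and a scalar matrix. -/
def bimul {m n k l : Type*} [Fintype n] [Fintype k] (α : Matrix m n ℂ) (v : Matrix n k V)
    (β : Matrix k l ℂ) : Matrix m l V :=
  Matrix.of fun i j => ∑ a, ∑ b, (α i a * β b j) • v a b

/-- The block diagonal matrix `v ⊕ w` in `M_{m+n}(V)`. -/
def directSum {m n : ℕ} (v : Matrix (Fin m) (Fin m) V) (w : Matrix (Fin n) (Fin n) V) :
    Matrix (Fin (m + n)) (Fin (m + n)) V :=
  Matrix.reindex finSumFinEquiv finSumFinEquiv (Matrix.fromBlocks v 0 0 w)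

theorem bimul_map {W : Type*} [AddCommGroup W] [Module ℂ W] {m n k l : Type*} [Fintype n]
    [Fintype k] (f : V →ₗ[ℂ] W) (α : Matrix m n ℂ) (v : Matrix n k V) (β : Matrix k l ℂ) :
    (bimul α v β).map f = bimul α (v.map f) β := by
  ext i j
  simp [bimul]

theorem directSum_map {W : Type*} [AddCommGroup W] [Module ℂ W] {m n : ℕ} (f : V →ₗ[ℂ] W)
    (v : Matrix (Fin m) (Fin m) V) (w : Matrix (Fin n) (Fin n) V) :
    (directSum v w).map f = directSum (v.map f) (w.map f) := by
  simp only [directSum, Matrix.reindex_apply, ← Matrix.submatrix_map, Matrix.fromBlocks_map]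
  congr 2 <;> ext <;> simp

/-- The scalar matrix that selects the left block. -/
def blockL (m n : ℕ) : Matrix (Fin m) (Fin (m + n)) ℂ :=
  Matrix.of fun i j => if Fin.castAdd n i = j then 1 else 0

/-- The scalar matrix that selects the right block. -/
def blockR (m n : ℕ) : Matrix (Fin n) (Fin (m + n)) ℂ :=
  Matrix.of fun i j => if Fin.natAdd m i = j then 1 else 0

theorem norm_blockL_le (m n : ℕ) : ‖blockL m n‖ ≤ 1 := by
  have h : (blockL m n)ᴴᴴ * (blockL m n)ᴴ = 1 := by
    ext i j
    simp [Matrix.mul_apply, blockL, Matrix.one_apply, eq_comm]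
  have h2 := Matrix.l2_opNorm_conjTranspose_mul_self (blockL m n)ᴴ
  rw [h, Matrix.l2_opNorm_conjTranspose] at h2
  have h3 : ‖(1 : Matrix (Fin m) (Fin m) ℂ)‖ ≤ 1 := by
    rw [← Matrix.diagonal_one, Matrix.l2_opNorm_diagonal]
    exact (pi_norm_le_iff_of_nonneg zero_le_one).2 fun i => by simp
  nlinarith [norm_nonneg (blockL m n)]

theorem norm_blockR_le (m n : ℕ) : ‖blockR m n‖ ≤ 1 := by
  have h : (blockR m n)ᴴᴴ * (blockR m n)ᴴ = 1 := by
    ext i j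
    simp [Matrix.mul_apply, blockR, Matrix.one_apply, eq_comm]
  have h2 := Matrix.l2_opNorm_conjTranspose_mul_self (blockR m n)ᴴ
  rw [h, Matrix.l2_opNorm_conjTranspose] at h2
  have h3 : ‖(1 : Matrix (Fin n) (Fin n) ℂ)‖ ≤ 1 := by
    rw [← Matrix.diagonal_one, Matrix.l2_opNorm_diagonal]
    exact (pi_norm_le_iff_of_nonneg zero_le_one).2 fun i => by simp
  nlinarith [norm_nonneg (blockR m n)]

theorem bimul_blockL {m n : ℕ} (v : Matrix (Fin m) (Fin m) V) (w : Matrix (Fin n) (Fin n) V) :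
    bimul (blockL m n) (directSum v w) (blockL m n)ᴴ = v := by
  ext i j
  simp [bimul, blockL, directSum, ite_smul]

theorem bimul_blockR {m n : ℕ} (v : Matrix (Fin m) (Fin m) V) (w : Matrix (Fin n) (Fin n) V) :
    bimul (blockR m n) (directSum v w) (blockR m n)ᴴ = w := by
  ext i j
  simp [bimul, blockR, directSum, ite_smul]

theorem max_le_of_compress (N : ∀ n : ℕ, Matrix (Fin n) (Fin n) V → ℝ)
    (h0 : ∀ n v, 0 ≤ N n v)
    (h : ∀ {m n : ℕ} (α : Matrix (Fin m) (Fin n) ℂ) (v : Matrix (Fin n) (Fin n) V)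
      (β : Matrix (Fin n) (Fin m) ℂ), N m (bimul α v β) ≤ ‖α‖ * N n v * ‖β‖)
    {m n : ℕ} (v : Matrix (Fin m) (Fin m) V) (w : Matrix (Fin n) (Fin n) V) :
    max (N m v) (N n w) ≤ N (m + n) (directSum v w) := by
  have key : ∀ a b x : ℝ, 0 ≤ a → a ≤ 1 → 0 ≤ b → b ≤ 1 → 0 ≤ x → a * x * b ≤ x :=
    fun a b x ha ha' hb hb' hx => by
      calc a * x * b ≤ 1 * x * 1 := by gcongr
        _ = x := by ring
  refine max_le ?_ ?_
  · have := h (blockL m n) (directSum v w) (blockL m n)ᴴ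
    rw [bimul_blockL] at this
    refine this.trans (key _ _ _ (norm_nonneg _) (norm_blockL_le m n) (norm_nonneg _) ?_ (h0 _ _))
    rw [Matrix.l2_opNorm_conjTranspose]; exact norm_blockL_le m n
  · have := h (blockR m n) (directSum v w) (blockR m n)ᴴ
    rw [bimul_blockR] at this
    refine this.trans (key _ _ _ (norm_nonneg _) (norm_blockR_le m n) (norm_nonneg _) ?_ (h0 _ _))
    rw [Matrix.l2_opNorm_conjTranspose]; exact norm_blockR_le m n

end MatrixOps

/-- An operator space structure on a complex normed space `V`: a norm on each matrix space
`M_n(V)`, agreeing with the given norm at level one and satisfying Ruan's two axioms.  Scalar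
matrices carry the operator norm. -/
class OperatorSpace (V : Type*) [NormedAddCommGroup V] [NormedSpace ℂ V] where
  mnorm : ∀ n : ℕ, Seminorm ℂ (Matrix (Fin n) (Fin n) V)
  mnorm_eq_zero : ∀ {n : ℕ} (v : Matrix (Fin n) (Fin n) V), mnorm n v = 0 → v = 0
  mnorm_one : ∀ v : Matrix (Fin 1) (Fin 1) V, mnorm 1 v = ‖v 0 0‖
  mnorm_directSum : ∀ {m n : ℕ} (v : Matrix (Fin m) (Fin m) V) (w : Matrix (Fin n) (Fin n) V),
    mnorm (m + n) (directSum v w) = max (mnorm m v) (mnorm n w)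
  mnorm_bimul_le : ∀ {m n : ℕ} (α : Matrix (Fin m) (Fin n) ℂ) (v : Matrix (Fin n) (Fin n) V)
    (β : Matrix (Fin n) (Fin m) ℂ), mnorm m (bimul α v β) ≤ ‖α‖ * mnorm n v * ‖β‖

section Subspace
variable {V : Type*} [NormedAddCommGroup V] [NormedSpace ℂ V] [OperatorSpace V]

/-- A subspace of an operator space, with the inherited matrix norms. -/
noncomputable instance instSubspace (X : Submodule ℂ V) : OperatorSpace X where
  mnorm n := (OperatorSpace.mnorm (V := V) n).comp (X.subtype.mapMatrix)
  mnorm_eq_zero v h := by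
    have := OperatorSpace.mnorm_eq_zero _ h
    ext i j
    simpa using congrFun (congrFun this i) j
  mnorm_one v := OperatorSpace.mnorm_one _
  mnorm_directSum v w := by
    change OperatorSpace.mnorm _ ((directSum v w).map X.subtype) = _
    rw [directSum_map, OperatorSpace.mnorm_directSum]; rfl
  mnorm_bimul_le α v β := by
    change OperatorSpace.mnorm _ ((bimul α v β).map X.subtype) ≤ _
    rw [bimul_map]; exact OperatorSpace.mnorm_bimul_le _ _ _

theorem norm_entry_le_mnorm {n : ℕ} (v : Matrix (Fin n) (Fin n) V) (i j : Fin n) :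
    ‖v i j‖ ≤ OperatorSpace.mnorm n v := by
  have h := OperatorSpace.mnorm_bimul_le (m := 1)
    (Matrix.of fun (_ : Fin 1) a => star ((EuclideanSpace.single i (1 : ℂ)) a)) v
    (Matrix.of fun b (_ : Fin 1) => (EuclideanSpace.single j (1 : ℂ)) b)
  rw [OperatorSpace.mnorm_one] at h
  have h1 := norm_rowMatrix_le (EuclideanSpace.single i (1 : ℂ))
  have h2 := norm_colMatrix_le (EuclideanSpace.single j (1 : ℂ))
  have h3 : bimul (Matrix.of fun (_ : Fin 1) a => star ((EuclideanSpace.single i (1 : ℂ)) a)) v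
    (Matrix.of fun b (_ : Fin 1) => (EuclideanSpace.single j (1 : ℂ)) b) 0 0 = v i j := by
    simp [bimul, ite_smul]
  rw [h3] at h
  simp only [PiLp.norm_single, norm_one] at h1 h2
  refine h.trans ?_
  calc _ ≤ 1 * OperatorSpace.mnorm n v * 1 := by gcongr
    _ = _ := by ring

end Subspace

section MatrixAlgebra

/-- The matrix algebra `M_n`, with `M_k(M_n)` normed as `M_{k × n}`. -/
noncomputable instance instMatrixAlgebra (n : ℕ) :
    OperatorSpace (Matrix (Fin n) (Fin n) ℂ) where
  mnorm k := (normSeminorm ℂ (Matrix (Fin k × Fin n) (Fin k × Fin n) ℂ)).comp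
    (Matrix.compLinearEquiv (Fin k) (Fin k) (Fin n) (Fin n) ℂ ℂ).toLinearMap
  mnorm_eq_zero v h := by
    have h' : Matrix.comp _ _ _ _ _ v = 0 := norm_eq_zero.1 h
    ext i j a b
    exact congrFun (congrFun h' (i, a)) (j, b)
  mnorm_one v := by
    change ‖Matrix.comp _ _ _ _ _ v‖ = _
    rw [← norm_reindex (Equiv.uniqueProd (Fin n) (Fin 1))]
    congr 1
  mnorm_directSum {p q} v w := by
    change ‖Matrix.comp _ _ _ _ _ (directSum v w)‖ =
      max ‖Matrix.comp _ _ _ _ _ v‖ ‖Matrix.comp _ _ _ _ _ w‖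
    rw [← norm_fromBlocks_diag,
      ← norm_reindex ((Equiv.prodCongr finSumFinEquiv.symm (Equiv.refl (Fin n))).trans
        (Equiv.sumProdDistrib (Fin p) (Fin q) (Fin n)))]
    congr 1
    ext (a | a) (b | b) <;> simp [directSum]
  mnorm_bimul_le {p q} α v β := by
    change ‖Matrix.comp _ _ _ _ _ (bimul α v β)‖ ≤ ‖α‖ * ‖Matrix.comp _ _ _ _ _ v‖ * ‖β‖
    have h : Matrix.comp _ _ _ _ _ (bimul α v β) =
        (α ⊗ₖ (1 : Matrix (Fin n) (Fin n) ℂ)) * Matrix.comp _ _ _ _ _ v *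
          (β ⊗ₖ (1 : Matrix (Fin n) (Fin n) ℂ)) := by
      ext ⟨i, a⟩ ⟨j, b⟩
      simp only [Matrix.comp_apply, bimul, Matrix.of_apply, Matrix.sum_apply, Matrix.smul_apply,
        smul_eq_mul, Matrix.mul_apply, Fintype.sum_prod_type, Matrix.kroneckerMap_apply,
        Matrix.one_apply, mul_ite, ite_mul, mul_one, mul_zero, zero_mul,
        Finset.sum_ite_eq, Finset.sum_ite_eq', Finset.mem_univ, if_true, Finset.sum_mul]
      rw [Finset.sum_comm]
      refine Finset.sum_congr rfl fun x _ => Finset.sum_congr rfl fun y _ => ?_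
      ring
    rw [h]
    calc _ ≤ ‖α ⊗ₖ (1 : Matrix (Fin n) (Fin n) ℂ)‖ * ‖Matrix.comp _ _ _ _ _ v‖ *
          ‖β ⊗ₖ (1 : Matrix (Fin n) (Fin n) ℂ)‖ :=
        (Matrix.l2_opNorm_mul _ _).trans
          (mul_le_mul_of_nonneg_right (Matrix.l2_opNorm_mul _ _) (norm_nonneg _))
      _ ≤ _ := by
        gcongr <;> exact norm_kronecker_one_le _

end MatrixAlgebra

section Dual
variable {V : Type*} [NormedAddCommGroup V] [NormedSpace ℂ V]

/-- The matrix pairing of `f ∈ M_n(V*)` and `x ∈ M_m(V)`, a matrix in `M_{n × m}`. -/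
noncomputable def matrixPairing {n m : ℕ} (f : Matrix (Fin n) (Fin n) (StrongDual ℂ V))
    (x : Matrix (Fin m) (Fin m) V) : Matrix (Fin n × Fin m) (Fin n × Fin m) ℂ :=
  Matrix.of fun p q => f p.1 q.1 (x p.2 q.2)

variable [OperatorSpace V]

/-- The norm of `f ∈ M_n(V*)`, that is, the completely bounded norm of the map `V → M_n` whose
matrix of coordinates is `f`. -/
noncomputable def dualNorm {n : ℕ} (f : Matrix (Fin n) (Fin n) (StrongDual ℂ V)) : ℝ :=
  sInf {C : ℝ | 0 ≤ C ∧ ∀ (m : ℕ) (x : Matrix (Fin m) (Fin m) V),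
    ‖matrixPairing f x‖ ≤ C * OperatorSpace.mnorm m x}

theorem norm_map_le (g : StrongDual ℂ V) {m : ℕ} (x : Matrix (Fin m) (Fin m) V) :
    ‖(x.map g : Matrix (Fin m) (Fin m) ℂ)‖ ≤ ‖g‖ * OperatorSpace.mnorm m x := by
  refine norm_le_of_sesq _ _ (fun ξ η => ?_)
    (mul_nonneg (norm_nonneg _) (apply_nonneg _ _))
  have h := OperatorSpace.mnorm_bimul_le (m := 1)
    (Matrix.of fun (_ : Fin 1) a => star (ξ a)) x (Matrix.of fun b (_ : Fin 1) => η b)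
  rw [OperatorSpace.mnorm_one] at h
  have h1 : ∑ i, ∑ j, (star (ξ i) * η j) • (x.map g) i j =
      g (bimul (Matrix.of fun (_ : Fin 1) a => star (ξ a)) x
        (Matrix.of fun b (_ : Fin 1) => η b) 0 0) := by
    simp [bimul]
  rw [h1]
  refine (g.le_opNorm _).trans ?_
  have h2 := norm_rowMatrix_le ξ
  have h3 := norm_colMatrix_le η
  calc _ ≤ ‖g‖ * (‖ξ‖ * OperatorSpace.mnorm m x * ‖η‖) := by
        refine mul_le_mul_of_nonneg_left (h.trans ?_) (norm_nonneg _)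
        gcongr
    _ = _ := by ring

theorem exists_dual_bound {n : ℕ} (f : Matrix (Fin n) (Fin n) (StrongDual ℂ V)) :
    ∃ C : ℝ, 0 ≤ C ∧ ∀ (m : ℕ) (x : Matrix (Fin m) (Fin m) V),
      ‖matrixPairing f x‖ ≤ C * OperatorSpace.mnorm m x := by
  refine ⟨∑ i, ∑ j, ‖(Matrix.single i j 1 : Matrix (Fin n) (Fin n) ℂ)‖ * ‖f i j‖,
    by positivity, fun m x => ?_⟩
  have h : matrixPairing f x = ∑ i, ∑ j,
      ((Matrix.single i j 1 : Matrix (Fin n) (Fin n) ℂ) ⊗ₖ (1 : Matrix (Fin m) (Fin m) ℂ)) *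
        ((1 : Matrix (Fin n) (Fin n) ℂ) ⊗ₖ x.map (f i j)) := by
    ext ⟨a, b⟩ ⟨c, d⟩
    simp only [← Matrix.mul_kronecker_mul, Matrix.sum_apply, Matrix.mul_one, Matrix.one_mul,
      Matrix.kroneckerMap_apply, matrixPairing, Matrix.of_apply, Matrix.map_apply,
      Matrix.single_apply]
    rw [Finset.sum_eq_single a (by intro i _ hi; simp [hi]) (by simp),
      Finset.sum_eq_single c (by intro i _ hi; simp [hi]) (by simp)]
    simp
  rw [h, Finset.sum_mul]
  refine (norm_sum_le _ _).trans (Finset.sum_le_sum fun i _ => ?_)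
  rw [Finset.sum_mul]
  refine (norm_sum_le _ _).trans (Finset.sum_le_sum fun j _ => ?_)
  refine (Matrix.l2_opNorm_mul _ _).trans ?_
  rw [mul_assoc]
  refine mul_le_mul (norm_kronecker_one_le _) ?_ (norm_nonneg _) (norm_nonneg _)
  refine le_trans ?_ (norm_map_le (f i j) x)
  rw [← norm_reindex (Equiv.prodComm (Fin n) (Fin m))]
  refine le_trans (le_of_eq ?_) (norm_kronecker_one_le (k := Fin n) (x.map (f i j)))
  congr 1
  ext ⟨a, b⟩ ⟨c, d⟩
  simp [mul_comm]

theorem dualNorm_le {n : ℕ} (f : Matrix (Fin n) (Fin n) (StrongDual ℂ V)) {C : ℝ} (h0 : 0 ≤ C)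
    (hC : ∀ (m : ℕ) (x : Matrix (Fin m) (Fin m) V),
      ‖matrixPairing f x‖ ≤ C * OperatorSpace.mnorm m x) : dualNorm f ≤ C :=
  csInf_le ⟨0, fun _ h => h.1⟩ ⟨h0, hC⟩

theorem dualNorm_nonneg {n : ℕ} (f : Matrix (Fin n) (Fin n) (StrongDual ℂ V)) :
    0 ≤ dualNorm f :=
  le_csInf (exists_dual_bound f) fun _ h => h.1

theorem norm_matrixPairing_le {n m : ℕ} (f : Matrix (Fin n) (Fin n) (StrongDual ℂ V))
    (x : Matrix (Fin m) (Fin m) V) :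
    ‖matrixPairing f x‖ ≤ dualNorm f * OperatorSpace.mnorm m x := by
  rcases eq_or_lt_of_le (apply_nonneg (OperatorSpace.mnorm (V := V) m) x) with h | h
  · obtain ⟨C, -, hC⟩ := exists_dual_bound f
    simpa [← h] using hC m x
  · rw [← div_le_iff₀ h]
    exact le_csInf (exists_dual_bound f) fun C hC => (div_le_iff₀ h).2 (hC.2 m x)

theorem dualNorm_bimul_le {m n : ℕ} (α : Matrix (Fin m) (Fin n) ℂ)
    (f : Matrix (Fin n) (Fin n) (StrongDual ℂ V)) (β : Matrix (Fin n) (Fin m) ℂ) :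
    dualNorm (bimul α f β) ≤ ‖α‖ * dualNorm f * ‖β‖ := by
  refine dualNorm_le _ (mul_nonneg (mul_nonneg (norm_nonneg _) (dualNorm_nonneg _))
    (norm_nonneg _)) fun k x => ?_
  have h : matrixPairing (bimul α f β) x =
      (α ⊗ₖ (1 : Matrix (Fin k) (Fin k) ℂ)) * matrixPairing f x *
        (β ⊗ₖ (1 : Matrix (Fin k) (Fin k) ℂ)) := by
    ext ⟨i, a⟩ ⟨j, b⟩
    simp only [matrixPairing, bimul, Matrix.of_apply, _root_.sum_apply, _root_.smul_apply, smul_eq_mul, Matrix.mul_apply, Fintype.sum_prod_type, Matrix.kroneckerMap_apply,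
      Matrix.one_apply, mul_ite, ite_mul, mul_one, mul_zero, zero_mul,
      Finset.sum_ite_eq, Finset.sum_ite_eq', Finset.mem_univ, if_true, Finset.sum_mul]
    rw [Finset.sum_comm]
    refine Finset.sum_congr rfl fun x _ => Finset.sum_congr rfl fun y _ => ?_
    ring
  rw [h]
  calc _ ≤ ‖α ⊗ₖ (1 : Matrix (Fin k) (Fin k) ℂ)‖ * ‖matrixPairing f x‖ *
        ‖β ⊗ₖ (1 : Matrix (Fin k) (Fin k) ℂ)‖ :=
      (Matrix.l2_opNorm_mul _ _).trans
        (mul_le_mul_of_nonneg_right (Matrix.l2_opNorm_mul _ _) (norm_nonneg _))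
    _ ≤ ‖α‖ * (dualNorm f * OperatorSpace.mnorm k x) * ‖β‖ := by
      refine mul_le_mul (mul_le_mul (norm_kronecker_one_le α) (norm_matrixPairing_le f x)
        (norm_nonneg _) (norm_nonneg _)) (norm_kronecker_one_le β) (norm_nonneg _) ?_
      exact mul_nonneg (norm_nonneg _) ((norm_nonneg _).trans (norm_matrixPairing_le f x))
    _ = _ := by ring

/-- The dual norm as a seminorm. -/
noncomputable def dualSeminorm (n : ℕ) : Seminorm ℂ (Matrix (Fin n) (Fin n) (StrongDual ℂ V)) :=
  Seminorm.ofSMulLE (𝕜 := ℂ) (E := Matrix (Fin n) (Fin n) (StrongDual ℂ V)) dualNorm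
    (le_antisymm (dualNorm_le _ le_rfl fun m x => by
      have h : matrixPairing (0 : Matrix (Fin n) (Fin n) (StrongDual ℂ V)) x = 0 := by
        ext; simp [matrixPairing]
      simp [h]) (dualNorm_nonneg _))
    (fun f g => dualNorm_le _ (add_nonneg (dualNorm_nonneg _) (dualNorm_nonneg _)) fun m x => by
      have h : matrixPairing (f + g) x = matrixPairing f x + matrixPairing g x := by
        ext; simp [matrixPairing]
      rw [h, add_mul]
      exact (norm_add_le _ _).trans
        (add_le_add (norm_matrixPairing_le f x) (norm_matrixPairing_le g x)))
    (fun c f => dualNorm_le _ (mul_nonneg (norm_nonneg _) (dualNorm_nonneg _)) fun m x => by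
      have h : matrixPairing (c • f) x = c • matrixPairing f x := by
        ext; simp [matrixPairing]
      rw [h, norm_smul, mul_assoc]
      exact mul_le_mul_of_nonneg_left (norm_matrixPairing_le f x) (norm_nonneg _))

/-- The operator space dual `V*`, with `M_n(V*) = CB(V, M_n)`. -/
noncomputable instance instDual : OperatorSpace (StrongDual ℂ V) where
  mnorm n := dualSeminorm n
  mnorm_eq_zero {n} f h := by
    have h' : dualNorm f = 0 := h
    ext i j v
    have h1 := norm_matrixPairing_le f (Matrix.of fun (_ _ : Fin 1) => v)
    rw [h', zero_mul] at h1
    have h2 := (norm_entry_le _ (i, 0) (j, 0)).trans h1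
    simpa [matrixPairing] using h2
  mnorm_one f := by
    change dualNorm f = _
    refine le_antisymm (dualNorm_le _ (norm_nonneg _) fun m x => ?_)
      (ContinuousLinearMap.opNorm_le_bound _ (dualNorm_nonneg _) fun v => ?_)
    · rw [← norm_reindex (Equiv.uniqueProd (Fin m) (Fin 1))]
      exact norm_map_le (f 0 0) x
    · have h1 := norm_matrixPairing_le f (Matrix.of fun (_ _ : Fin 1) => v)
      rw [OperatorSpace.mnorm_one] at h1
      exact (norm_entry_le _ (0, 0) (0, 0)).trans h1
  mnorm_directSum {p q} f g := by
    change dualNorm (directSum f g) = max (dualNorm f) (dualNorm g)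
    refine le_antisymm (dualNorm_le _ (le_max_of_le_left (dualNorm_nonneg _)) fun m x => ?_)
      (max_le_of_compress (fun n f => dualNorm f) (fun _ f => dualNorm_nonneg f)
        dualNorm_bimul_le f g)
    rw [← norm_reindex ((Equiv.prodCongr finSumFinEquiv.symm (Equiv.refl (Fin m))).trans
        (Equiv.sumProdDistrib (Fin p) (Fin q) (Fin m)))]
    have h : Matrix.reindex ((Equiv.prodCongr finSumFinEquiv.symm (Equiv.refl (Fin m))).trans
        (Equiv.sumProdDistrib (Fin p) (Fin q) (Fin m)))
        ((Equiv.prodCongr finSumFinEquiv.symm (Equiv.refl (Fin m))).trans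
        (Equiv.sumProdDistrib (Fin p) (Fin q) (Fin m))) (matrixPairing (directSum f g) x) =
        Matrix.fromBlocks (matrixPairing f x) 0 0 (matrixPairing g x) := by
      ext (a | a) (b | b) <;> simp [directSum, matrixPairing]
    rw [h, norm_fromBlocks_diag, max_mul_of_nonneg _ _ (apply_nonneg _ _)]
    exact max_le_max (norm_matrixPairing_le f x) (norm_matrixPairing_le g x)
  mnorm_bimul_le α f β := dualNorm_bimul_le α f β

end Dual

section Quotient
variable {V : Type*} [NormedAddCommGroup V] [NormedSpace ℂ V] [OperatorSpace V]

/-- The norm of a matrix over `V ⧸ X`: the infimum of the norms of its lifts. -/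
noncomputable def quotientNorm (X : Submodule ℂ V) {n : ℕ} (q : Matrix (Fin n) (Fin n) (V ⧸ X)) :
    ℝ :=
  sInf {r : ℝ | ∃ v : Matrix (Fin n) (Fin n) V, v.map X.mkQ = q ∧ r = OperatorSpace.mnorm n v}

theorem exists_lift (X : Submodule ℂ V) {n : ℕ} (q : Matrix (Fin n) (Fin n) (V ⧸ X)) :
    ∃ v : Matrix (Fin n) (Fin n) V, v.map X.mkQ = q := by
  choose g hg using X.mkQ_surjective
  exact ⟨q.map g, by ext; simp only [Matrix.map_apply, hg]⟩

theorem quotientNorm_le (X : Submodule ℂ V) {n : ℕ} (v : Matrix (Fin n) (Fin n) V) :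
    quotientNorm X (v.map X.mkQ) ≤ OperatorSpace.mnorm n v :=
  csInf_le ⟨0, by rintro _ ⟨v, -, rfl⟩; exact apply_nonneg _ _⟩ ⟨v, rfl, rfl⟩

theorem le_quotientNorm (X : Submodule ℂ V) {n : ℕ} (q : Matrix (Fin n) (Fin n) (V ⧸ X)) {C : ℝ}
    (h : ∀ v : Matrix (Fin n) (Fin n) V, v.map X.mkQ = q → C ≤ OperatorSpace.mnorm n v) :
    C ≤ quotientNorm X q := by
  obtain ⟨v, hv⟩ := exists_lift X q
  refine le_csInf ⟨_, v, hv, rfl⟩ ?_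
  rintro _ ⟨w, hw, rfl⟩
  exact h w hw

theorem quotientNorm_nonneg (X : Submodule ℂ V) {n : ℕ} (q : Matrix (Fin n) (Fin n) (V ⧸ X)) :
    0 ≤ quotientNorm X q :=
  le_quotientNorm X q fun _ _ => apply_nonneg _ _

theorem quotientNorm_bimul_le (X : Submodule ℂ V) {m n : ℕ} (α : Matrix (Fin m) (Fin n) ℂ)
    (q : Matrix (Fin n) (Fin n) (V ⧸ X)) (β : Matrix (Fin n) (Fin m) ℂ) :
    quotientNorm X (bimul α q β) ≤ ‖α‖ * quotientNorm X q * ‖β‖ := by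
  have key : ∀ v : Matrix (Fin n) (Fin n) V, v.map X.mkQ = q →
      quotientNorm X (bimul α q β) ≤ (‖α‖ * ‖β‖) * OperatorSpace.mnorm n v := by
    rintro v rfl
    rw [← bimul_map]
    refine (quotientNorm_le X _).trans ((OperatorSpace.mnorm_bimul_le α v β).trans (le_of_eq ?_))
    ring
  rw [mul_right_comm]
  rcases eq_or_lt_of_le (mul_nonneg (norm_nonneg α) (norm_nonneg β)) with h | h
  · obtain ⟨v, hv⟩ := exists_lift X q
    simpa [← h] using key v hv
  · rw [← div_le_iff₀' h]
    exact le_quotientNorm X q fun v hv => (div_le_iff₀' h).2 (key v hv)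

/-- The quotient `V ⧸ X` of an operator space by a closed subspace. -/
noncomputable instance instQuotient (X : Submodule ℂ V) [IsClosed (X : Set V)] :
    OperatorSpace (V ⧸ X) where
  mnorm n := Seminorm.ofSMulLE (fun q => quotientNorm X q)
    (le_antisymm ((quotientNorm_le X (0 : Matrix (Fin n) (Fin n) V)).trans_eq' (by
      congr 1) |>.trans_eq (map_zero _)) (quotientNorm_nonneg X _))
    (fun p q => by
      rw [← sub_le_iff_le_add]
      refine le_quotientNorm X p fun v hv => ?_
      rw [sub_le_comm]
      refine le_quotientNorm X q fun w hw => ?_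
      rw [sub_le_iff_le_add']
      have h : p + q = (v + w).map X.mkQ := by subst hv hw; ext; simp
      rw [h]
      exact (quotientNorm_le X _).trans (map_add_le_add _ _ _))
    (fun c q => by
      have key : ∀ v : Matrix (Fin n) (Fin n) V, v.map X.mkQ = q →
          quotientNorm X (c • q) ≤ ‖c‖ * OperatorSpace.mnorm n v := by
        rintro v rfl
        have h : c • v.map X.mkQ = (c • v).map X.mkQ := by ext; simp
        rw [h]
        exact (quotientNorm_le X _).trans_eq (map_smul_eq_mul _ _ _)
      rcases eq_or_lt_of_le (norm_nonneg c) with h | h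
      · obtain ⟨v, hv⟩ := exists_lift X q
        simpa [← h] using key v hv
      · rw [← div_le_iff₀' h]
        exact le_quotientNorm X q fun v hv => (div_le_iff₀' h).2 (key v hv))
  mnorm_eq_zero {n} q h := by
    have h' : quotientNorm X q = 0 := h
    ext i j
    have h1 : ‖q i j‖ ≤ quotientNorm X q := by
      refine le_quotientNorm X q ?_
      rintro v rfl
      exact (Submodule.Quotient.norm_mk_le X (v i j)).trans (norm_entry_le_mnorm v i j)
    rw [h'] at h1
    simpa using h1
  mnorm_one q := by
    change quotientNorm X q = _
    refine le_antisymm (le_of_forall_pos_le_add fun ε hε => ?_) (le_quotientNorm X q ?_)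
    · obtain ⟨v, hv, hlt⟩ := Submodule.Quotient.norm_mk_lt (q 0 0) hε
      have h : q = (Matrix.of fun (_ _ : Fin 1) => v).map X.mkQ := by
        ext i j
        rw [Subsingleton.elim i 0, Subsingleton.elim j 0]
        exact hv.symm
      conv_lhs => rw [h]
      refine (quotientNorm_le X _).trans ?_
      rw [OperatorSpace.mnorm_one]
      exact hlt.le
    · rintro v rfl
      rw [OperatorSpace.mnorm_one]
      exact Submodule.Quotient.norm_mk_le X (v 0 0)
  mnorm_directSum p q := by
    change quotientNorm X (directSum p q) = max (quotientNorm X p) (quotientNorm X q)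
    refine le_antisymm (le_of_forall_pos_le_add fun ε hε => ?_)
      (max_le_of_compress (fun n q => quotientNorm X q) (fun _ q => quotientNorm_nonneg X q)
        (quotientNorm_bimul_le X) p q)
    have lift : ∀ {n : ℕ} (r : Matrix (Fin n) (Fin n) (V ⧸ X)),
        ∃ v : Matrix (Fin n) (Fin n) V, v.map X.mkQ = r ∧
          OperatorSpace.mnorm n v ≤ quotientNorm X r + ε := by
      intro n r
      by_contra! hcon
      have := le_quotientNorm X r fun v hv => (hcon v hv).le
      linarith
    obtain ⟨v, rfl, hv⟩ := lift p
    obtain ⟨w, rfl, hw⟩ := lift q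
    rw [← directSum_map, ← max_add_add_right]
    refine (quotientNorm_le X _).trans ?_
    rw [OperatorSpace.mnorm_directSum]
    exact max_le_max hv hw
  mnorm_bimul_le α q β := quotientNorm_bimul_le X α q β

end Quotient

/-- The Banach space dual `V*`, for the norm topology of `V`. -/
abbrev Dual (V : Type*) [NormedAddCommGroup V] [NormedSpace ℂ V] : Type _ := StrongDual ℂ V

section TraceClass

/-- The operator space `T_n` of trace-class operators on `ℂⁿ`, as the operator space dual of
`M_n`. -/
abbrev TraceClass (n : ℕ) : Type := Dual (Matrix (Fin n) (Fin n) ℂ)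

instance instIsClosed (n : ℕ) (X : Submodule ℂ (TraceClass n)) :
    IsClosed (X : Set (TraceClass n)) :=
  X.closed_of_finiteDimensional

end TraceClass

section Main

/-- The completely bounded norm of a linear map, with value `∞` if the map is not completely
bounded. -/
noncomputable def cbNorm {V W : Type*} [NormedAddCommGroup V] [NormedSpace ℂ V] [OperatorSpace V]
    [NormedAddCommGroup W] [NormedSpace ℂ W] [OperatorSpace W] (φ : V →ₗ[ℂ] W) : ℝ≥0∞ :=
  ⨆ (n : ℕ) (x : Matrix (Fin n) (Fin n) V) (_ : OperatorSpace.mnorm n x ≤ 1),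
    ENNReal.ofReal (OperatorSpace.mnorm n (x.map φ))

/-- The completely bounded Banach-Mazur distance, the infimum of `‖θ‖_cb ‖θ⁻¹‖_cb` over all
complete isomorphisms `θ`, with value `∞` if there are none. -/
noncomputable def dcb (V W : Type*) [NormedAddCommGroup V] [NormedSpace ℂ V] [OperatorSpace V]
    [NormedAddCommGroup W] [NormedSpace ℂ W] [OperatorSpace W] : ℝ≥0∞ :=
  ⨅ (θ : V ≃ₗ[ℂ] W) (_ : cbNorm θ.toLinearMap < ⊤) (_ : cbNorm θ.symm.toLinearMap < ⊤),
    cbNorm θ.toLinearMap * cbNorm θ.symm.toLinearMap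

/-- `V` (finite-dimensional) is `c`-coexact: it is, up to `c + ε`, a quotient of some `T_n`. -/
def IsCoexact (c : ℝ≥0) (V : Type*) [NormedAddCommGroup V] [NormedSpace ℂ V]
    [OperatorSpace V] : Prop :=
  ∀ ε : ℝ≥0, 0 < ε → ∃ (n : ℕ) (X : Submodule ℂ (TraceClass n)),
    dcb V (TraceClass n ⧸ X) < c + ε

/-- `V` is `c`-subcoexact: each finite-dimensional subspace is contained in a finite-dimensional
subspace that is `c`-coexact. -/
def IsSubcoexact (c : ℝ≥0) (V : Type*) [NormedAddCommGroup V] [NormedSpace ℂ V]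
    [OperatorSpace V] : Prop :=
  ∀ W : Submodule ℂ V, FiniteDimensional ℂ W →
    ∃ X : Submodule ℂ V, W ≤ X ∧ FiniteDimensional ℂ X ∧ IsCoexact c X

/-- The operator space bidual. -/
abbrev Bidual (V : Type*) [NormedAddCommGroup V] [NormedSpace ℂ V] : Type _ :=
  Dual (Dual V)

/-- `V` is locally reflexive with constant `c`: each complete contraction `φ` from a
finite-dimensional operator space `W` to `V**` is the point-weak* limit of a net (here, along a
proper filter) of maps `W → V` with completely bounded norm at most `c`. -/
def IsLocallyReflexiveWith (c : ℝ≥0) (V : Type u) [NormedAddCommGroup V] [NormedSpace ℂ V]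
    [OperatorSpace V] : Prop :=
  ∀ (W : Type w) [NormedAddCommGroup W] [NormedSpace ℂ W] [OperatorSpace W]
    [FiniteDimensional ℂ W] (φ : W →ₗ[ℂ] Bidual V), cbNorm (W := Bidual V) φ ≤ 1 →
    ∃ (ι : Type (max u w)) (l : Filter ι) (Φ : ι → W →ₗ[ℂ] V), l.NeBot ∧
      (∀ i, cbNorm (Φ i) ≤ c) ∧
      ∀ (x : W) (f : Dual V), Tendsto (fun i => f (Φ i x)) l (𝓝 (φ x f))

/-- `V` is locally reflexive: complete contractions from finite-dimensional operator spaces to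
`V**` are point-weak* limits of complete contractions to `V`. -/
def IsLocallyReflexive (V : Type u) [NormedAddCommGroup V] [NormedSpace ℂ V]
    [OperatorSpace V] : Prop :=
  IsLocallyReflexiveWith.{u, w} 1 V

end Main

end OpSpace

/-! A complete contraction `φ : W → V**` has finite-dimensional range, so its range lies in a
coexact `E ⊆ V**`, and `E` is `(λ + ε)`-close to some `T_n ⧸ X`. Through the isomorphism, the
inclusion of `E` becomes a map `T_n ⧸ X → V**`. It then suffices to approximate that map,
point-weak*, by maps `T_n ⧸ X → V` with the same completely bounded norm bound, and to precompose
them with `W → E → T_n ⧸ X`.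

Maps on `T_n` make this possible. A matrix in `M_n(V)` induces a map `T_n → V` whose cb norm is at
most its matrix norm (`mnorm_map_traceClassMap_le`), and the maps that vanish on `X` form a subspace
`Z` of `M_n(V)`. The approximation is Goldstine's theorem for `Z`, proved by Hahn–Banach in
`mem_closure_annihilatorBall`. It needs two facts: elements of `M_n(V**)` that vanish on `X` are
invisible to functionals annihilating `Z` (`tracePairing_eq_zero_of_annihilates`), and `M_n(V**)`
maps contractively into the bidual of `M_n(V)` (`norm_tracePairing_bidual_le`).

The analytic core is `exists_factorization`: a contractive functional on `M_n(V)` has the form `A F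
B`, with `F` in the unit ball of `M_n(V*)` and with `A`, `B` of Hilbert–Schmidt norm almost at most
one. Pairing with such a product is a scalar product against the matrix of `F`, so the definition of
the dual norm bounds it. The factorization comes from separating a convex cone from an open convex
set; Ruan's axioms make the cone convex and disjoint from that set. Finally
`mem_closure_of_forall_add` removes the `ε`. -/

namespace OpSpace

/-! ### The trace pairing between `M_n(V*)` and `M_n(V)` -/

section TracePairing
variable {V : Type*} [NormedAddCommGroup V] [NormedSpace ℂ V]

/-- The scalar pairing `∑ f i j (v i j)` of `f ∈ M_n(V*)` and `v ∈ M_n(V)`. -/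
noncomputable def tracePairing (n : ℕ) : Matrix (Fin n) (Fin n) (StrongDual ℂ V) →ₗ[ℂ]
    Matrix (Fin n) (Fin n) V →ₗ[ℂ] ℂ :=
  LinearMap.mk₂ ℂ (fun f v => ∑ i, ∑ j, f i j (v i j))
    (fun f g v => by simp [Finset.sum_add_distrib])
    (fun c f v => by simp [Finset.mul_sum])
    (fun f v w => by simp [Finset.sum_add_distrib])
    (fun c f v => by simp [Finset.mul_sum])

theorem tracePairing_apply {n : ℕ} (f : Matrix (Fin n) (Fin n) (StrongDual ℂ V))
    (v : Matrix (Fin n) (Fin n) V) : tracePairing n f v = ∑ i, ∑ j, f i j (v i j) := rfl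

theorem tracePairing_bimul {m n : ℕ} (f : Matrix (Fin n) (Fin n) (StrongDual ℂ V))
    (α : Matrix (Fin n) (Fin m) ℂ) (x : Matrix (Fin m) (Fin m) V) (β : Matrix (Fin m) (Fin n) ℂ) :
    tracePairing n f (bimul α x β) = ∑ i, ∑ j, ∑ a, ∑ b, α i a * β b j * f i j (x a b) := by
  simp [tracePairing_apply, bimul]

theorem append_mul_conjTranspose {n m k : ℕ} (α : Matrix (Fin n) (Fin m) ℂ)
    (γ : Matrix (Fin n) (Fin k) ℂ) :
    (Matrix.of fun i => Fin.append (α i) (γ i)) * (Matrix.of fun i => Fin.append (α i) (γ i))ᴴ =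
      α * αᴴ + γ * γᴴ := by
  ext i j
  simp [Matrix.mul_apply, Fin.sum_univ_add]

/-- Concatenating columns turns a sum of two products `α x β*` into a single one with a block
diagonal middle factor. This is what makes `dominationCone` closed under addition. -/
theorem tracePairing_bimul_append {n m k : ℕ} (f : Matrix (Fin n) (Fin n) (StrongDual ℂ V))
    (α : Matrix (Fin n) (Fin m) ℂ) (γ : Matrix (Fin n) (Fin k) ℂ)
    (x : Matrix (Fin m) (Fin m) V) (y : Matrix (Fin k) (Fin k) V)
    (β : Matrix (Fin n) (Fin m) ℂ) (δ : Matrix (Fin n) (Fin k) ℂ) :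
    tracePairing n f (bimul (Matrix.of fun i => Fin.append (α i) (γ i)) (directSum x y)
      (Matrix.of fun i => Fin.append (β i) (δ i))ᴴ) =
    tracePairing n f (bimul α x βᴴ) + tracePairing n f (bimul γ y δᴴ) := by
  simp only [tracePairing_bimul, ← Finset.sum_add_distrib]
  refine Finset.sum_congr rfl fun i _ => Finset.sum_congr rfl fun j _ => ?_
  simp [Fin.sum_univ_add, directSum]

end TracePairing

theorem l2_opNorm_mul_conjTranspose_self {m n : Type*} [Fintype m] [Fintype n] [DecidableEq m]
    [DecidableEq n] (α : Matrix m n ℂ) : ‖α * αᴴ‖ = ‖α‖ * ‖α‖ := by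
  have h := Matrix.l2_opNorm_conjTranspose_mul_self αᴴ
  rwa [Matrix.conjTranspose_conjTranspose, Matrix.l2_opNorm_conjTranspose] at h

theorem l2_opNorm_one_le (n : Type*) [Fintype n] [DecidableEq n] :
    ‖(1 : Matrix n n ℂ)‖ ≤ 1 := by
  rw [← Matrix.diagonal_one, Matrix.l2_opNorm_diagonal]
  exact (pi_norm_le_iff_of_nonneg zero_le_one).2 fun i => by simp

/-! ### Domination of functionals on `M_n(V)` by Hahn–Banach -/

section Domination
variable {V : Type*} [NormedAddCommGroup V] [NormedSpace ℂ V] [OperatorSpace V]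

/-- The convex cone that is separated from `{(a, b, r) | ‖a‖ + ‖b‖ < r}`. -/
def dominationCone {n : ℕ} (f : Matrix (Fin n) (Fin n) (StrongDual ℂ V)) :
    Set (Matrix (Fin n) (Fin n) ℂ × Matrix (Fin n) (Fin n) ℂ × ℂ) :=
  {e | ∃ (m : ℕ) (α β : Matrix (Fin n) (Fin m) ℂ) (x : Matrix (Fin m) (Fin m) V),
    OperatorSpace.mnorm m x ≤ 1 ∧
      e = (α * αᴴ, β * βᴴ, ((2 * (tracePairing n f (bimul α x βᴴ)).re : ℝ) : ℂ))}

/-- Multiplying both `α` and `β` by `√t` scales all three coordinates by `t` and leaves `x` alone.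
-/
theorem smul_mem_dominationCone {n : ℕ} {f : Matrix (Fin n) (Fin n) (StrongDual ℂ V)}
    {e : Matrix (Fin n) (Fin n) ℂ × Matrix (Fin n) (Fin n) ℂ × ℂ} (he : e ∈ dominationCone f)
    {t : ℝ} (ht : 0 ≤ t) : t • e ∈ dominationCone f := by
  obtain ⟨m, α, β, x, hx, rfl⟩ := he
  have h2 : (((√t : ℝ) : ℂ)) * ((√t : ℝ) : ℂ) = (t : ℂ) := by
    rw [← Complex.ofReal_mul, Real.mul_self_sqrt ht]
  have h3 : ∀ a : Matrix (Fin n) (Fin m) ℂ, t • (a * aᴴ) =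
      (((√t : ℝ) : ℂ) • a) * (((√t : ℝ) : ℂ) • a)ᴴ := fun a => by
    simp only [Matrix.conjTranspose_smul, Matrix.smul_mul, Matrix.mul_smul, smul_smul]
    simp [h2]
  refine ⟨m, ((√t : ℝ) : ℂ) • α, ((√t : ℝ) : ℂ) • β, x, hx, ?_⟩
  have h1 : tracePairing n f (bimul (((√t : ℝ) : ℂ) • α) x (((√t : ℝ) : ℂ) • β)ᴴ) =
      (t : ℂ) * tracePairing n f (bimul α x βᴴ) := by
    simp only [tracePairing_bimul, Finset.mul_sum]
    refine Finset.sum_congr rfl fun i _ => Finset.sum_congr rfl fun j _ =>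
      Finset.sum_congr rfl fun a _ => Finset.sum_congr rfl fun b _ => ?_
    rw [← h2]
    simp
    ring
  rw [h1, Complex.re_ofReal_mul, ← h3, ← h3]
  refine Prod.ext rfl (Prod.ext rfl ?_)
  simp
  ring

/-- Ruan's direct sum axiom keeps `x ⊕ y` in the unit ball; the size `m` is left free in the cone
for this reason. -/
theorem add_mem_dominationCone {n : ℕ} {f : Matrix (Fin n) (Fin n) (StrongDual ℂ V)}
    {e e' : Matrix (Fin n) (Fin n) ℂ × Matrix (Fin n) (Fin n) ℂ × ℂ} (he : e ∈ dominationCone f)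
    (he' : e' ∈ dominationCone f) : e + e' ∈ dominationCone f := by
  obtain ⟨m, α, β, x, hx, rfl⟩ := he
  obtain ⟨k, γ, δ, y, hy, rfl⟩ := he'
  refine ⟨m + k, Matrix.of fun i => Fin.append (α i) (γ i),
    Matrix.of fun i => Fin.append (β i) (δ i), directSum x y, ?_, ?_⟩
  · rw [OperatorSpace.mnorm_directSum]
    exact max_le hx hy
  · rw [append_mul_conjTranspose, append_mul_conjTranspose, tracePairing_bimul_append]
    refine Prod.ext rfl (Prod.ext rfl ?_)
    simp
    ring

/-- A contractive functional on `M_n(V)` is dominated by two functionals on `M_n` that play the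
role of states. -/
theorem exists_dominating_functionals {n : ℕ} (f : Matrix (Fin n) (Fin n) (StrongDual ℂ V))
    (hf : ∀ v, ‖tracePairing n f v‖ ≤ OperatorSpace.mnorm n v) :
    ∃ p q : Matrix (Fin n) (Fin n) ℂ →ₗ[ℂ] ℂ, (p 1).re ≤ 1 ∧ (q 1).re ≤ 1 ∧
      ∀ (m : ℕ) (α β : Matrix (Fin n) (Fin m) ℂ) (x : Matrix (Fin m) (Fin m) V),
        OperatorSpace.mnorm m x ≤ 1 →
        2 * (tracePairing n f (bimul α x βᴴ)).re ≤ (p (α * αᴴ)).re + (q (β * βᴴ)).re := by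
  let U : Set (Matrix (Fin n) (Fin n) ℂ × Matrix (Fin n) (Fin n) ℂ × ℂ) :=
    {e | ‖e.1‖ + ‖e.2.1‖ < e.2.2.re}
  have hU : IsOpen U := by
    refine isOpen_lt (by fun_prop) ?_
    exact Complex.continuous_re.comp (continuous_snd.comp continuous_snd)
  have hUc : Convex ℝ U := by
    intro a ha b hb s t hs ht hst
    change ‖s • a.1 + t • b.1‖ + ‖s • a.2.1 + t • b.2.1‖ < (s • a.2.2 + t • b.2.2).re
    have h1 : ‖s • a.1 + t • b.1‖ ≤ s * ‖a.1‖ + t * ‖b.1‖ := by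
      refine (norm_add_le _ _).trans_eq ?_
      rw [norm_smul_of_nonneg hs, norm_smul_of_nonneg ht]
    have h2 : ‖s • a.2.1 + t • b.2.1‖ ≤ s * ‖a.2.1‖ + t * ‖b.2.1‖ := by
      refine (norm_add_le _ _).trans_eq ?_
      rw [norm_smul_of_nonneg hs, norm_smul_of_nonneg ht]
    have ha' : ‖a.1‖ + ‖a.2.1‖ < a.2.2.re := ha
    have hb' : ‖b.1‖ + ‖b.2.1‖ < b.2.2.re := hb
    have h3 : (s • a.2.2 + t • b.2.2).re = s * a.2.2.re + t * b.2.2.re := by simp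
    rw [h3]
    rcases eq_or_lt_of_le hs with h | h
    · obtain rfl : t = 1 := by linarith
      subst h; linarith
    · nlinarith [mul_le_mul_of_nonneg_left hb'.le ht, mul_lt_mul_of_pos_left ha' h]
  have hCc : Convex ℝ (dominationCone f) := fun a ha b hb s t hs ht _ =>
    add_mem_dominationCone (smul_mem_dominationCone ha hs) (smul_mem_dominationCone hb ht)
  -- On the cone, `2 Re f(α x β*) ≤ 2‖α‖‖β‖ ≤ ‖α‖² + ‖β‖² = ‖αα*‖ + ‖ββ*‖`, which contradicts
  -- membership in `U`.
  have hdisj : Disjoint U (dominationCone f) := by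
    rw [Set.disjoint_left]
    rintro _ h ⟨m, α, β, x, hx, rfl⟩
    have h' : ‖α * αᴴ‖ + ‖β * βᴴ‖ < 2 * (tracePairing n f (bimul α x βᴴ)).re := h
    rw [l2_opNorm_mul_conjTranspose_self, l2_opNorm_mul_conjTranspose_self] at h'
    have h1 : (tracePairing n f (bimul α x βᴴ)).re ≤ ‖α‖ * ‖β‖ := by
      refine (Complex.re_le_norm _).trans ((hf _).trans
        ((OperatorSpace.mnorm_bimul_le _ _ _).trans ?_))
      rw [Matrix.l2_opNorm_conjTranspose]
      calc _ ≤ ‖α‖ * 1 * ‖β‖ := by gcongr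
        _ = _ := by ring
    nlinarith [sq_nonneg (‖α‖ - ‖β‖)]
  obtain ⟨L, s, hLU, hLC⟩ := RCLike.geometric_hahn_banach_open (𝕜 := ℂ) hUc hU hCc hdisj
  simp only [RCLike.re_to_complex] at hLU hLC
  have hs : s ≤ 0 := by
    have := hLC _ (smul_mem_dominationCone (t := 0) (f := f)
      ⟨0, 0, 0, 0, by simp, rfl⟩ le_rfl)
    simpa using this
  -- A functional bounded below on a cone is nonnegative there: a negative value could be scaled
  -- down to `s - 1`.
  have hC : ∀ e ∈ dominationCone f, 0 ≤ (L e).re := by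
    intro e he
    by_contra! hneg
    have h1 := hLC _ (smul_mem_dominationCone he
      (t := (s - 1) / (L e).re) (div_nonneg_of_nonpos (by linarith) hneg.le))
    rw [(L : _ →L[ℂ] ℂ).map_smul_of_tower, Complex.smul_re, smul_eq_mul,
      div_mul_cancel₀ _ hneg.ne] at h1
    linarith
  have hk : 0 < -(L (0, 0, 1)).re := by
    have := hLU (0, 0, 1) (by simp [U])
    linarith
  -- Dividing the first two components of `L` by `κ` normalizes the weight of the third coordinate.
  -- Positivity on the cone then reads as the required domination.
  set κ : ℝ := -(L (0, 0, 1)).re with hκ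
  have hsplit : ∀ (a b : Matrix (Fin n) (Fin n) ℂ) (r : ℝ),
      (L (a, b, (r : ℂ))).re = (L (a, 0, 0)).re + (L (0, b, 0)).re - r * κ := by
    intro a b r
    have h : (a, b, (r : ℂ)) = (a, 0, 0) + (0, b, 0) +
      r • ((0, 0, 1) : Matrix (Fin n) (Fin n) ℂ × Matrix (Fin n) (Fin n) ℂ × ℂ) := by simp
    rw [h, map_add, map_add, (L : _ →L[ℂ] ℂ).map_smul_of_tower]
    simp [hκ]
  -- The point with third coordinate `‖a‖ + ‖b‖` is on the boundary of `U`; the `δ / κ` moves it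
  -- inside. Taking `(a, b)` to be `(1, 0)` and `(0, 1)` bounds `p 1` and `q 1`.
  have hbound : ∀ a b : Matrix (Fin n) (Fin n) ℂ,
      (L (a, 0, 0)).re + (L (0, b, 0)).re ≤ κ * (‖a‖ + ‖b‖) := by
    intro a b
    refine le_of_forall_pos_le_add fun δ hδ => ?_
    have h1 := hLU (a, b, ((‖a‖ + ‖b‖ + δ / κ : ℝ) : ℂ)) (by
      change ‖a‖ + ‖b‖ < (((‖a‖ + ‖b‖ + δ / κ : ℝ) : ℂ)).re
      rw [Complex.ofReal_re]
      linarith [div_pos hδ hk])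
    rw [hsplit, add_mul, div_mul_cancel₀ _ hk.ne'] at h1
    linarith
  have h0 : L (0, 0, 0) = 0 := map_zero L
  have h1 := l2_opNorm_one_le (Fin n)
  refine ⟨((κ⁻¹ : ℝ) : ℂ) • L.toLinearMap ∘ₗ LinearMap.inl ℂ _ _,
    ((κ⁻¹ : ℝ) : ℂ) • L.toLinearMap ∘ₗ LinearMap.inr ℂ _ _ ∘ₗ LinearMap.inl ℂ _ _, ?_, ?_, ?_⟩
  · have h2 := hbound 1 0
    simp only [h0, norm_zero, add_zero, Complex.zero_re] at h2
    change (((κ⁻¹ : ℝ) : ℂ) * L (1, 0, 0)).re ≤ 1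
    rw [Complex.re_ofReal_mul, inv_mul_le_one₀ hk]
    nlinarith
  · have h2 := hbound 0 1
    simp only [h0, norm_zero, zero_add, Complex.zero_re] at h2
    change (((κ⁻¹ : ℝ) : ℂ) * L (0, 1, 0)).re ≤ 1
    rw [Complex.re_ofReal_mul, inv_mul_le_one₀ hk]
    nlinarith
  · intro m α β x hx
    have h2 := hC _ ⟨m, α, β, x, hx, rfl⟩
    rw [hsplit] at h2
    change _ ≤ (((κ⁻¹ : ℝ) : ℂ) * L (α * αᴴ, 0, 0)).re + (((κ⁻¹ : ℝ) : ℂ) * L (0, β * βᴴ, 0)).re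
    rw [Complex.re_ofReal_mul, Complex.re_ofReal_mul, ← mul_add, ← div_eq_inv_mul, le_div_iff₀ hk]
    linarith

end Domination

/-! ### Factorization of functionals on `M_n(V)` -/

section Factorization

open scoped ComplexOrder MatrixOrder in
/-- Up to `ε`, a functional that is nonnegative on the squares `α αᴴ` is implemented by an
invertible matrix. -/
theorem exists_implementing_matrix {n : ℕ} (p : Matrix (Fin n) (Fin n) ℂ →ₗ[ℂ] ℂ)
    (hp : ∀ (m : ℕ) (α : Matrix (Fin n) (Fin m) ℂ), 0 ≤ (p (α * αᴴ)).re) {ε : ℝ} (hε : 0 < ε) :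
    ∃ S : Matrix (Fin n) (Fin n) ℂ, IsUnit S.det ∧
      ∀ (m : ℕ) (α : Matrix (Fin n) (Fin m) ℂ),
        ∑ i, ∑ a, ‖(S * α) i a‖ ^ 2 = (p (α * αᴴ)).re + ε * ∑ i, ∑ a, ‖α i a‖ ^ 2 := by
  have htr : ∀ {k m : ℕ} (α : Matrix (Fin k) (Fin m) ℂ),
      ((α * αᴴ).trace).re = ∑ i, ∑ a, ‖α i a‖ ^ 2 := by
    intro k m α
    simp [Matrix.trace, Matrix.mul_apply, Complex.mul_conj, Complex.normSq_eq_norm_sq,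
      -Complex.ofReal_pow]
  let G : Matrix (Fin n) (Fin n) ℂ := Matrix.of fun j i => p (Matrix.single i j 1)
  have hG : ∀ a, p a = (G * a).trace := by
    intro a
    conv_lhs => rw [Matrix.matrix_eq_sum_single a]
    simp only [map_sum, Matrix.trace, Matrix.diag_apply, Matrix.mul_apply]
    rw [Finset.sum_comm]
    refine Finset.sum_congr rfl fun j _ => Finset.sum_congr rfl fun i _ => ?_
    have h : Matrix.single i j (a i j) = a i j • Matrix.single i j (1 : ℂ) := by
      rw [Matrix.smul_single, smul_eq_mul, mul_one]
    rw [h, map_smul, smul_eq_mul, mul_comm]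
    rfl
  -- Only the real parts of `p` on the matrices `αα*` are controlled, and these see just the
  -- Hermitian part of the density `G`.
  let P : Matrix (Fin n) (Fin n) ℂ := (2⁻¹ : ℂ) • (G + Gᴴ)
  have hP : P.IsHermitian := by
    simp only [P, Matrix.IsHermitian, Matrix.conjTranspose_smul, Matrix.conjTranspose_add,
      Matrix.conjTranspose_conjTranspose, add_comm]
    simp
  have hPα : ∀ {m : ℕ} (α : Matrix (Fin n) (Fin m) ℂ),
      ((P * (α * αᴴ)).trace).re = (p (α * αᴴ)).re := by
    intro m α
    have h1 : ((Gᴴ * (α * αᴴ)).trace).re = ((G * (α * αᴴ)).trace).re := by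
      have h2 : (Gᴴ * (α * αᴴ)) = ((α * αᴴ) * G)ᴴ := by
        simp [Matrix.conjTranspose_mul]
      rw [h2, Matrix.trace_conjTranspose, Matrix.trace_mul_comm]
      simp
    rw [hG, Matrix.smul_mul, Matrix.trace_smul, Matrix.add_mul, Matrix.trace_add, smul_eq_mul]
    have h3 : (2⁻¹ : ℂ) = ((2⁻¹ : ℝ) : ℂ) := by simp
    rw [h3, Complex.re_ofReal_mul, Complex.add_re, h1]
    ring
  have hPpos : P.PosSemidef := by
    refine Matrix.PosSemidef.of_dotProduct_mulVec_nonneg hP fun ξ => ?_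
    -- A single column makes `αα*` of rank at most one, so the hypothesis becomes positivity of the
    -- quadratic form of `P`.
    let α : Matrix (Fin n) (Fin 1) ℂ := Matrix.of fun i _ => ξ i
    have h1 := hp 1 α
    rw [← hPα] at h1
    have h2 : (P * (α * αᴴ)).trace = star ξ ⬝ᵥ (P *ᵥ ξ) := by
      rw [← Matrix.mul_assoc, Matrix.trace_mul_comm]
      simp [Matrix.trace, Matrix.mul_apply, dotProduct, Matrix.mulVec, α]
    rw [h2] at h1
    have h3 := hP.im_star_dotProduct_mulVec_self ξ
    exact Complex.nonneg_iff.2 ⟨h1, by simpa using h3.symm⟩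
  -- The `ε` makes the form definite, hence its root `S`, with `S* S = P + ε`, invertible.
  have hPε : (P + (ε : ℂ) • (1 : Matrix (Fin n) (Fin n) ℂ)).PosDef := by
    exact Matrix.PosDef.posSemidef_add hPpos
      (Matrix.PosDef.one.smul (by exact_mod_cast hε))
  obtain ⟨S, hS⟩ := CStarAlgebra.nonneg_iff_eq_star_mul_self.mp hPε.posSemidef.nonneg
  rw [Matrix.star_eq_conjTranspose] at hS
  refine ⟨S, ?_, fun m α => ?_⟩
  · have h1 := hPε.isUnit
    rw [hS, Matrix.isUnit_iff_isUnit_det, Matrix.det_mul] at h1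
    exact isUnit_of_mul_isUnit_right h1
  · rw [← htr, ← htr, Matrix.conjTranspose_mul, Matrix.trace_mul_comm, ← hPα]
    have h1 : αᴴ * Sᴴ * (S * α) = αᴴ * ((P + (ε : ℂ) • (1 : Matrix (Fin n) (Fin n) ℂ)) * α) := by
      rw [hS]; simp only [Matrix.mul_assoc]
    rw [h1, Matrix.trace_mul_comm, Matrix.mul_assoc, Matrix.add_mul, Matrix.trace_add,
      Matrix.smul_mul (ε : ℂ), Matrix.one_mul, Matrix.trace_smul, smul_eq_mul, Complex.add_re,
      Complex.re_ofReal_mul]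

/-- A matrix is a contraction if its sesquilinear form is dominated by the mean of the squared
norms. -/
theorem norm_le_one_of_sesq_re {m n : Type*} [Fintype m] [Fintype n] [DecidableEq m]
    [DecidableEq n] (K : Matrix m n ℂ)
    (hK : ∀ (ξ : m → ℂ) (η : n → ℂ),
      2 * (∑ i, ∑ j, star (ξ i) * η j * K i j).re ≤ ∑ i, ‖ξ i‖ ^ 2 + ∑ j, ‖η j‖ ^ 2) :
    ‖K‖ ≤ 1 := by
  rw [Matrix.l2_opNorm_def]
  refine ContinuousLinearMap.opNorm_le_bound _ zero_le_one fun η => ?_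
  set y := ((Matrix.toEuclideanLin.trans LinearMap.toContinuousLinearMap) K) η with hy
  have hyi : ∀ i, y i = ∑ j, K i j * η j := fun i => by
    simp [hy, Matrix.mulVec, dotProduct]
  -- With `ξ = y = Kη` the hypothesis reads `2‖y‖² ≤ ‖y‖² + ‖η‖²`.
  have h := hK y η
  have h2 : ∑ i, ∑ j, star (y i) * η j * K i j = ((∑ i, ‖y i‖ ^ 2 : ℝ) : ℂ) := by
    rw [Complex.ofReal_sum]
    refine Finset.sum_congr rfl fun i _ => ?_
    rw [← Complex.normSq_eq_norm_sq, ← Complex.mul_conj, mul_comm]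
    conv_rhs => rw [hyi i, Finset.mul_sum]
    refine Finset.sum_congr rfl fun j _ => ?_
    rw [← hyi]
    simp only [RCLike.star_def]
    ring
  rw [h2, Complex.ofReal_re] at h
  rw [one_mul, EuclideanSpace.norm_eq, EuclideanSpace.norm_eq]
  exact Real.sqrt_le_sqrt (by linarith)

theorem sum_reorder {m n : ℕ}
    (T : Fin n → Fin m → Fin n → Fin m → Fin n → Fin n → ℂ) :
    ∑ p, ∑ a, ∑ q, ∑ b, ∑ i, ∑ j, T p a q b i j = ∑ i, ∑ j, ∑ a, ∑ b, ∑ p, ∑ q, T p a q b i j := by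
  simp only [← Fintype.sum_prod_type']
  exact Fintype.sum_equiv
    ⟨fun x => (x.2.2.2.2.1, x.2.2.2.2.2, x.2.1, x.2.2.2.1, x.1, x.2.2.1),
      fun y => (y.2.2.2.2.1, y.2.2.1, y.2.2.2.2.2, y.2.2.2.1, y.1, y.2.1),
      fun _ => rfl, fun _ => rfl⟩ _ _ fun _ => rfl

variable {V : Type*} [NormedAddCommGroup V] [NormedSpace ℂ V] [OperatorSpace V]

/-- A contractive functional on `M_n(V)` factors, up to `ε`, through a complete contraction
`V → M_n` and two Hilbert–Schmidt contractions. -/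
theorem exists_factorization {n : ℕ} (f : Matrix (Fin n) (Fin n) (StrongDual ℂ V))
    (hf : ∀ v, ‖tracePairing n f v‖ ≤ OperatorSpace.mnorm n v) {ε : ℝ} (hε : 0 < ε) :
    ∃ (A B : Matrix (Fin n) (Fin n) ℂ) (F : Matrix (Fin n) (Fin n) (StrongDual ℂ V)),
      f = bimul A F B ∧ OperatorSpace.mnorm n F ≤ 1 ∧
      ∑ i, ∑ j, ‖A i j‖ ^ 2 ≤ 1 + ε ∧ ∑ i, ∑ j, ‖B i j‖ ^ 2 ≤ 1 + ε := by
  obtain ⟨p, q, hp1, hq1, hpq⟩ := exists_dominating_functionals f hf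
  -- The perturbation enters the Hilbert–Schmidt norms multiplied by `‖1‖² = n`, so this choice
  -- costs at most `ε`; the `+ 1` covers `n = 0`.
  have hδ : 0 < ε / (n + 1) := by positivity
  have hp : ∀ (m : ℕ) (α : Matrix (Fin n) (Fin m) ℂ), 0 ≤ (p (α * αᴴ)).re := fun m α => by
    simpa [tracePairing_bimul] using hpq m α 0 0 (by simp)
  have hq : ∀ (m : ℕ) (α : Matrix (Fin n) (Fin m) ℂ), 0 ≤ (q (α * αᴴ)).re := fun m α => by
    simpa [tracePairing_bimul] using hpq m 0 α 0 (by simp)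
  obtain ⟨S, hSu, hS⟩ := exists_implementing_matrix p hp hδ
  obtain ⟨R, hRu, hR⟩ := exists_implementing_matrix q hq hδ
  have hn : ∑ i : Fin n, ∑ a : Fin n, ‖(1 : Matrix (Fin n) (Fin n) ℂ) i a‖ ^ 2 = n := by
    have : ∀ i a : Fin n, ‖(1 : Matrix (Fin n) (Fin n) ℂ) i a‖ ^ 2 = if i = a then (1 : ℝ) else 0 := by
      intro i a
      rw [Matrix.one_apply]
      split_ifs <;> simp
    simp [this]
  have hδn : ε / (n + 1) * n ≤ ε := by
    rw [div_mul_eq_mul_div, div_le_iff₀ (by positivity)]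
    nlinarith
  have hS1 := hS n 1
  have hR1 := hR n 1
  rw [Matrix.mul_one, hn, Matrix.conjTranspose_one, Matrix.mul_one] at hS1 hR1
  -- `F` is `f` with `S` and `R` divided out. Transposes appear because the pairing contracts the
  -- row index of `f` with the row index of `α`.
  let F : Matrix (Fin n) (Fin n) (StrongDual ℂ V) := bimul (S⁻¹)ᵀ f (R⁻¹ᴴ)ᵀ
  refine ⟨Sᵀ, Rᴴᵀ, F, ?_, ?_, ?_, ?_⟩
  · have hSS : S⁻¹ * S = 1 := Matrix.nonsing_inv_mul S hSu
    have hRR : Rᴴ * R⁻¹ᴴ = 1 := by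
      rw [← Matrix.conjTranspose_mul, Matrix.nonsing_inv_mul R hRu, Matrix.conjTranspose_one]
    have h1 : ∀ i k, ∑ a, S a i * S⁻¹ k a = if k = i then 1 else 0 := fun i k => by
      have := congrFun (congrFun hSS k) i
      rw [Matrix.mul_apply, Matrix.one_apply] at this
      rw [← this]
      exact Finset.sum_congr rfl fun a _ => mul_comm _ _
    have h2 : ∀ j l, ∑ b, Rᴴ j b * R⁻¹ᴴ b l = if j = l then 1 else 0 := fun j l => by
      have := congrFun (congrFun hRR j) l
      rwa [Matrix.mul_apply, Matrix.one_apply] at this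
    ext i j v
    have h3 : (bimul Sᵀ F Rᴴᵀ) i j v = ∑ k, ∑ l, (∑ a, S a i * S⁻¹ k a) *
        (∑ b, Rᴴ j b * R⁻¹ᴴ b l) * f k l v := by
      simp only [bimul, F, Matrix.of_apply, Matrix.transpose_apply, _root_.sum_apply,
        _root_.smul_apply, smul_eq_mul, Finset.sum_mul, Finset.mul_sum]
      calc _ = ∑ a, ∑ k, ∑ b, ∑ l, S a i * Rᴴ j b * (S⁻¹ k a * R⁻¹ᴴ b l * f k l v) :=
            Finset.sum_congr rfl fun a _ => Finset.sum_comm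
        _ = ∑ k, ∑ a, ∑ b, ∑ l, S a i * Rᴴ j b * (S⁻¹ k a * R⁻¹ᴴ b l * f k l v) :=
            Finset.sum_comm
        _ = ∑ k, ∑ l, ∑ b, ∑ a, S a i * Rᴴ j b * (S⁻¹ k a * R⁻¹ᴴ b l * f k l v) := by
            refine Finset.sum_congr rfl fun k _ => ?_
            rw [Finset.sum_comm]
            conv_rhs => rw [Finset.sum_comm]
            refine Finset.sum_congr rfl fun b _ => Finset.sum_comm
        _ = _ := by
            refine Finset.sum_congr rfl fun k _ => Finset.sum_congr rfl fun l _ =>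
              Finset.sum_congr rfl fun b _ => Finset.sum_congr rfl fun a _ => by ring
    rw [h3]
    simp only [h1, h2]
    simp
  · refine dualNorm_le _ zero_le_one fun m x => ?_
    rw [one_mul]
    have key : ∀ x : Matrix (Fin m) (Fin m) V, OperatorSpace.mnorm m x ≤ 1 →
        ‖matrixPairing F x‖ ≤ 1 := by
      intro x hx
      refine norm_le_one_of_sesq_re _ fun ξ η => ?_
      -- Vectors of `ℂⁿ ⊗ ℂᵐ` are read as matrices. Applying the domination to `S⁻¹ Ξ` and `R⁻¹ N`
      -- gives the Hilbert–Schmidt norms of `Ξ` and `N`, up to perturbation terms of favourable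
      -- sign.
      let Ξ : Matrix (Fin n) (Fin m) ℂ := Matrix.of fun i a => star (ξ (i, a))
      let N : Matrix (Fin n) (Fin m) ℂ := Matrix.of fun j b => star (η (j, b))
      have h1 := hpq m (S⁻¹ * Ξ) (R⁻¹ * N) x hx
      have h2 := hS m (S⁻¹ * Ξ)
      have h3 := hR m (R⁻¹ * N)
      rw [Matrix.mul_nonsing_inv_cancel_left _ _ hSu] at h2
      rw [Matrix.mul_nonsing_inv_cancel_left _ _ hRu] at h3
      have h4 : 0 ≤ ε / (n + 1) * ∑ i, ∑ a, ‖(S⁻¹ * Ξ) i a‖ ^ 2 := by positivity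
      have h5 : 0 ≤ ε / (n + 1) * ∑ i, ∑ a, ‖(R⁻¹ * N) i a‖ ^ 2 := by positivity
      have h6 : ∑ i, ‖ξ i‖ ^ 2 = ∑ i, ∑ a, ‖Ξ i a‖ ^ 2 := by
        rw [Fintype.sum_prod_type]; simp [Ξ]
      have h7 : ∑ i, ‖η i‖ ^ 2 = ∑ i, ∑ a, ‖N i a‖ ^ 2 := by
        rw [Fintype.sum_prod_type]; simp [N]
      have h8 : ∑ i, ∑ j, star (ξ i) * η j * matrixPairing F x i j =
          tracePairing n f (bimul (S⁻¹ * Ξ) x (R⁻¹ * N)ᴴ) := by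
        rw [tracePairing_bimul]
        simp only [Fintype.sum_prod_type, matrixPairing, F, bimul, Matrix.of_apply,
          _root_.sum_apply, _root_.smul_apply, smul_eq_mul, Matrix.conjTranspose_apply,
          Matrix.transpose_apply, Matrix.mul_apply, Finset.mul_sum, Finset.sum_mul, star_sum,
          star_mul', Ξ, N, star_star]
        refine (sum_reorder _).trans ?_
        refine Finset.sum_congr rfl fun i _ => Finset.sum_congr rfl fun j _ =>
          Finset.sum_congr rfl fun a _ => Finset.sum_congr rfl fun b _ => ?_
        conv_rhs => rw [Finset.sum_comm]
        refine Finset.sum_congr rfl fun p _ => Finset.sum_congr rfl fun q _ => ?_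
        ring
      rw [h8, h6, h7]
      linarith
    rcases eq_or_lt_of_le (apply_nonneg (OperatorSpace.mnorm (V := V) m) x) with h | h
    · rw [OperatorSpace.mnorm_eq_zero x h.symm]
      have : matrixPairing F (0 : Matrix (Fin m) (Fin m) V) = 0 := by
        ext; simp [matrixPairing]
      simp [this]
    · have h1 := key ((((OperatorSpace.mnorm m x)⁻¹ : ℝ) : ℂ) • x) (by
        rw [map_smul_eq_mul, Complex.norm_real, Real.norm_of_nonneg (by positivity),
          inv_mul_cancel₀ h.ne'])
      have h2 : matrixPairing F ((((OperatorSpace.mnorm m x)⁻¹ : ℝ) : ℂ) • x) =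
          (((OperatorSpace.mnorm m x)⁻¹ : ℝ) : ℂ) • matrixPairing F x := by
        ext; simp [matrixPairing]
      rwa [h2, norm_smul, Complex.norm_real, Real.norm_of_nonneg (by positivity),
        inv_mul_le_one₀ h] at h1
  · calc ∑ i, ∑ j, ‖Sᵀ i j‖ ^ 2 = ∑ i, ∑ j, ‖S i j‖ ^ 2 := Finset.sum_comm
      _ ≤ _ := by rw [hS1]; linarith
  · calc ∑ i, ∑ j, ‖Rᴴᵀ i j‖ ^ 2 = ∑ i, ∑ j, ‖R i j‖ ^ 2 := by simp
      _ ≤ _ := by rw [hR1]; linarith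

end Factorization

/-! ### Duality of matrix norms -/

section Duality
variable {V : Type*} [NormedAddCommGroup V] [NormedSpace ℂ V]

/-- The sum is the `1 × 1` product of a row, `K` and a column. It serves with `ξ`, `η` the entries
of the Hilbert–Schmidt factors of a functional. -/
theorem norm_bilin_le {m n : Type*} [Fintype m] [Fintype n] [DecidableEq m] [DecidableEq n]
    (K : Matrix m n ℂ) (ξ : m → ℂ) (η : n → ℂ) {c : ℝ} (hc : 0 ≤ c) (hξ : ∑ i, ‖ξ i‖ ^ 2 ≤ c)
    (hη : ∑ j, ‖η j‖ ^ 2 ≤ c) : ‖∑ i, ∑ j, ξ i * η j * K i j‖ ≤ c * ‖K‖ := by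
  have h1 := norm_rowMatrix_le (WithLp.toLp 2 fun i => star (ξ i))
  have h2 := norm_colMatrix_le (WithLp.toLp 2 η)
  rw [EuclideanSpace.norm_eq] at h1 h2
  have h3 : ∑ i, ∑ j, ξ i * η j * K i j =
      ((Matrix.of fun (_ : Fin 1) i => star ((WithLp.toLp 2 fun i => star (ξ i)) i)) * K *
        (Matrix.of fun i (_ : Fin 1) => (WithLp.toLp 2 η) i)) 0 0 := by
    simp only [Matrix.mul_apply, Matrix.of_apply, Finset.sum_mul, star_star]
    rw [Finset.sum_comm]
    exact Finset.sum_congr rfl fun j _ => Finset.sum_congr rfl fun i _ => by ring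
  rw [h3]
  refine (norm_entry_le _ _ _).trans ((Matrix.l2_opNorm_mul _ _).trans ?_)
  have h4 : √(∑ i, ‖star (ξ i)‖ ^ 2) ≤ √c := Real.sqrt_le_sqrt (by simpa using hξ)
  have h5 : √(∑ i, ‖η i‖ ^ 2) ≤ √c := Real.sqrt_le_sqrt hη
  calc _ ≤ (√c * ‖K‖) * √c := by
        refine mul_le_mul ((Matrix.l2_opNorm_mul _ _).trans ?_) (h2.trans h5) (norm_nonneg _)
          (by positivity)
        exact mul_le_mul_of_nonneg_right (h1.trans h4) (norm_nonneg _)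
    _ = (√c * √c) * ‖K‖ := by ring
    _ = c * ‖K‖ := by rw [Real.mul_self_sqrt hc]

variable [OperatorSpace V]

/-- `M_n(V**)` embeds contractively into the bidual of `M_n(V)`. -/
theorem norm_tracePairing_bidual_le {n : ℕ} (u : Matrix (Fin n) (Fin n) (Bidual V))
    (f : Matrix (Fin n) (Fin n) (Dual V))
    (hf : ∀ v, ‖tracePairing n f v‖ ≤ OperatorSpace.mnorm n v) :
    ‖tracePairing n u f‖ ≤ OperatorSpace.mnorm n u := by
  have key : ∀ ε : ℝ, 0 < ε → ‖tracePairing n u f‖ ≤ (1 + ε) * OperatorSpace.mnorm n u := by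
    intro ε hε
    obtain ⟨A, B, F, rfl, hF, hA, hB⟩ := exists_factorization f hf hε
    -- The entries of `A` and `B` become vectors of `ℂⁿ ⊗ ℂⁿ` on either side of the matrix `⟨u, F⟩`,
    -- whose norm is at most `‖u‖ ‖F‖` by definition of the norm of `M_n(V**)`.
    have h1 : tracePairing n u (bimul A F B) =
        ∑ x : Fin n × Fin n, ∑ y : Fin n × Fin n, A x.1 x.2 * B y.2 y.1 *
          matrixPairing u F x y := by
      rw [tracePairing_bimul]
      simp only [Fintype.sum_prod_type, matrixPairing, Matrix.of_apply]
      exact Finset.sum_congr rfl fun i _ => Finset.sum_comm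
    rw [h1]
    have hA' : ∑ x : Fin n × Fin n, ‖A x.1 x.2‖ ^ 2 ≤ 1 + ε := by rwa [Fintype.sum_prod_type]
    have hB' : ∑ y : Fin n × Fin n, ‖B y.2 y.1‖ ^ 2 ≤ 1 + ε := by
      rwa [Fintype.sum_prod_type, Finset.sum_comm]
    have h2 := norm_bilin_le (matrixPairing u F) (fun x => A x.1 x.2) (fun y => B y.2 y.1)
      (by positivity) hA' hB'
    have h3 : ‖matrixPairing u F‖ ≤ OperatorSpace.mnorm n u :=
      (norm_matrixPairing_le u F).trans (mul_le_of_le_one_right (dualNorm_nonneg u) hF)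
    exact h2.trans (mul_le_mul_of_nonneg_left h3 (by positivity))
  have h : Tendsto (fun ε : ℝ => (1 + ε) * OperatorSpace.mnorm n u) (𝓝[>] 0)
      (𝓝 ((1 + 0) * OperatorSpace.mnorm n u)) :=
    (Continuous.tendsto (by fun_prop) 0).mono_left nhdsWithin_le_nhds
  rw [add_zero, one_mul] at h
  exact ge_of_tendsto h (eventually_mem_nhdsWithin.mono fun ε hε => key ε hε)

theorem mnorm_single_le {n : ℕ} (i j : Fin n) (v : V) :
    OperatorSpace.mnorm n (Matrix.single i j v) ≤ ‖v‖ := by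
  have h1 := norm_colMatrix_le (EuclideanSpace.single i (1 : ℂ))
  have h2 := norm_rowMatrix_le (EuclideanSpace.single j (1 : ℂ))
  have h := OperatorSpace.mnorm_bimul_le
    (Matrix.of fun a (_ : Fin 1) => (EuclideanSpace.single i (1 : ℂ)) a)
    (Matrix.of fun (_ _ : Fin 1) => v)
    (Matrix.of fun (_ : Fin 1) a => star ((EuclideanSpace.single j (1 : ℂ)) a))
  rw [OperatorSpace.mnorm_one] at h
  simp only [PiLp.norm_single, norm_one] at h1 h2
  have h3 : bimul (Matrix.of fun a (_ : Fin 1) => (EuclideanSpace.single i (1 : ℂ)) a)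
      (Matrix.of fun (_ _ : Fin 1) => v)
      (Matrix.of fun (_ : Fin 1) a => star ((EuclideanSpace.single j (1 : ℂ)) a)) =
      Matrix.single i j v := by
    ext a b
    by_cases ha : a = i <;> by_cases hb : b = j <;>
      simp [bimul, ha, hb, Ne.symm, eq_comm]
  rw [h3] at h
  refine h.trans ?_
  calc _ ≤ 1 * ‖v‖ * 1 := by gcongr; rfl
    _ = _ := by ring

/-- The entries of `f` are the restrictions of `H` to the matrix positions, continuous because `v ↦
v ⊗ e_ij` is contractive. -/
theorem exists_tracePairing_eq {n : ℕ} (H : Matrix (Fin n) (Fin n) V →ₗ[ℂ] ℂ)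
    (hH : ∀ v, ‖H v‖ ≤ OperatorSpace.mnorm n v) :
    ∃ f : Matrix (Fin n) (Fin n) (StrongDual ℂ V), ∀ v, tracePairing n f v = H v := by
  refine ⟨Matrix.of fun i j => (H ∘ₗ Matrix.singleLinearMap ℂ i j).mkContinuous 1 fun v => ?_,
    fun v => ?_⟩
  · rw [one_mul]
    exact (hH _).trans (mnorm_single_le i j v)
  · conv_rhs => rw [Matrix.matrix_eq_sum_single v]
    simp only [map_sum]
    rfl

/-- The matrix norms of an operator space are determined by the complete contractions into
matrix algebras. -/
theorem mnorm_le_of_forall_dual {n : ℕ} (w : Matrix (Fin n) (Fin n) V) {C : ℝ} (hC : 0 ≤ C)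
    (h : ∀ F : Matrix (Fin n) (Fin n) (StrongDual ℂ V), OperatorSpace.mnorm n F ≤ 1 →
      ‖matrixPairing F w‖ ≤ C) : OperatorSpace.mnorm n w ≤ C := by
  by_cases hw : w = 0
  · rwa [hw, map_zero]
  -- A norming functional for `w`; its factorization supplies an `F` that almost attains the norm of
  -- `w`.
  obtain ⟨H, hHw, hH⟩ := Module.Dual.exists_extension_of_le_seminorm (Submodule.span ℂ {w})
    ((OperatorSpace.mnorm n w : ℂ) • (LinearEquiv.coord ℂ _ w hw).toLinearMap)
    (p := OperatorSpace.mnorm n) (fun x => by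
      conv_rhs => rw [← LinearEquiv.coord_apply_smul ℂ _ w hw x, map_smul_eq_mul]
      change ‖(OperatorSpace.mnorm n w : ℂ) * LinearEquiv.coord ℂ _ w hw x‖ ≤ _
      rw [norm_mul, Complex.norm_real, Real.norm_of_nonneg (apply_nonneg _ _), mul_comm])
  obtain ⟨f, hf⟩ := exists_tracePairing_eq H hH
  have hfw : ‖tracePairing n f w‖ = OperatorSpace.mnorm n w := by
    have h1 := hHw ⟨w, Submodule.mem_span_singleton_self w⟩
    rw [hf, h1]
    change ‖(OperatorSpace.mnorm n w : ℂ) * LinearEquiv.coord ℂ _ w hw _‖ = _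
    rw [LinearEquiv.coord_self, mul_one, Complex.norm_real,
      Real.norm_of_nonneg (apply_nonneg _ _)]
  have key : ∀ ε : ℝ, 0 < ε → OperatorSpace.mnorm n w ≤ (1 + ε) * C := by
    intro ε hε
    obtain ⟨A, B, F, hfF, hF, hA, hB⟩ := exists_factorization f (fun v => by rw [hf]; exact hH v) hε
    have h1 : tracePairing n f w =
        ∑ x : Fin n × Fin n, ∑ y : Fin n × Fin n, A x.2 x.1 * B y.1 y.2 *
          matrixPairing F w x y := by
      rw [tracePairing_apply, hfF]
      simp only [Fintype.sum_prod_type, matrixPairing, Matrix.of_apply, bimul, _root_.sum_apply,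
        _root_.smul_apply, smul_eq_mul]
      calc _ = ∑ i, ∑ a, ∑ j, ∑ b, A i a * B b j * F a b (w i j) :=
            Finset.sum_congr rfl fun i _ => Finset.sum_comm
        _ = ∑ a, ∑ i, ∑ j, ∑ b, A i a * B b j * F a b (w i j) := Finset.sum_comm
        _ = _ := Finset.sum_congr rfl fun a _ => Finset.sum_congr rfl fun i _ => Finset.sum_comm
    rw [← hfw, h1]
    have hA' : ∑ x : Fin n × Fin n, ‖A x.2 x.1‖ ^ 2 ≤ 1 + ε := by
      rwa [Fintype.sum_prod_type, Finset.sum_comm]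
    have hB' : ∑ y : Fin n × Fin n, ‖B y.1 y.2‖ ^ 2 ≤ 1 + ε := by rwa [Fintype.sum_prod_type]
    have h2 := norm_bilin_le (matrixPairing F w) (fun x => A x.2 x.1) (fun y => B y.1 y.2)
      (by positivity) hA' hB'
    exact h2.trans (mul_le_mul_of_nonneg_left (h F hF) (by positivity))
  have h : Tendsto (fun ε : ℝ => (1 + ε) * C) (𝓝[>] 0) (𝓝 ((1 + 0) * C)) :=
    (Continuous.tendsto (by fun_prop) 0).mono_left nhdsWithin_le_nhds
  rw [add_zero, one_mul] at h
  exact ge_of_tendsto h (eventually_mem_nhdsWithin.mono fun ε hε => key ε hε)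

end Duality

/-! ### Maps out of `T_n` as matrices -/

section TraceClassMaps

/-- The coordinate functionals of `M_n`, as a matrix over `T_n`. -/
noncomputable def coordMatrix (n : ℕ) : Matrix (Fin n) (Fin n) (TraceClass n) :=
  Matrix.of fun i j => LinearMap.toContinuousLinearMap (Matrix.entryLinearMap ℂ ℂ i j)

theorem coordMatrix_apply {n : ℕ} (i j : Fin n) (a : Matrix (Fin n) (Fin n) ℂ) :
    coordMatrix n i j a = a i j := rfl

/-- As a map `M_n → M_n` this matrix is the identity; pairing with it only exchanges the two tensor
factors. -/
theorem mnorm_coordMatrix_le (n : ℕ) : OperatorSpace.mnorm n (coordMatrix n) ≤ 1 := by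
  refine dualNorm_le _ zero_le_one fun m x => ?_
  rw [one_mul, ← norm_reindex (Equiv.prodComm (Fin n) (Fin m))]
  change _ ≤ ‖Matrix.comp _ _ _ _ _ x‖
  refine le_of_eq (congrArg _ ?_)
  ext ⟨a, i⟩ ⟨b, j⟩
  rfl

theorem traceClass_eq_sum {n : ℕ} (t : TraceClass n) :
    t = ∑ i, ∑ j, t (Matrix.single i j 1) • coordMatrix n i j := by
  ext a
  conv_lhs => rw [Matrix.matrix_eq_sum_single a]
  simp only [map_sum, _root_.sum_apply, _root_.smul_apply, smul_eq_mul, coordMatrix_apply]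
  refine Finset.sum_congr rfl fun i _ => Finset.sum_congr rfl fun j _ => ?_
  have h : Matrix.single i j (a i j) = a i j • Matrix.single i j (1 : ℂ) := by
    rw [Matrix.smul_single, smul_eq_mul, mul_one]
  rw [h, map_smul, smul_eq_mul, mul_comm]

variable {V : Type*} [NormedAddCommGroup V] [NormedSpace ℂ V]

/-- The map `T_n → V` given by `v ∈ M_n(V)`. -/
noncomputable def traceClassMap {n : ℕ} (v : Matrix (Fin n) (Fin n) V) : TraceClass n →ₗ[ℂ] V where
  toFun t := ∑ i, ∑ j, t (Matrix.single i j 1) • v i j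
  map_add' s t := by simp [add_smul, Finset.sum_add_distrib]
  map_smul' c t := by simp [mul_smul, Finset.smul_sum]

theorem traceClassMap_apply {n : ℕ} (v : Matrix (Fin n) (Fin n) V) (t : TraceClass n) :
    traceClassMap v t = ∑ i, ∑ j, t (Matrix.single i j 1) • v i j := rfl

variable [OperatorSpace V]

/-- Testing against `F` in the unit ball of `M_m(V*)` moves `v` to the other side: the result is `t`
paired with the matrix `F(v)` in `M_m(M_n)`, whose norm is at most `‖v‖`. -/
theorem mnorm_map_traceClassMap_le {n m : ℕ} (v : Matrix (Fin n) (Fin n) V)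
    (t : Matrix (Fin m) (Fin m) (TraceClass n)) :
    OperatorSpace.mnorm m (t.map (traceClassMap v)) ≤
      OperatorSpace.mnorm n v * OperatorSpace.mnorm m t := by
  rw [mul_comm]
  refine mnorm_le_of_forall_dual _ (mul_nonneg (apply_nonneg _ _) (apply_nonneg _ _))
    fun F hF => ?_
  let Y : Matrix (Fin m) (Fin m) (Matrix (Fin n) (Fin n) ℂ) :=
    Matrix.of fun p q => v.map (F p q)
  have h1 : Matrix.reindex (Equiv.prodComm (Fin m) (Fin m)) (Equiv.prodComm (Fin m) (Fin m))
      (matrixPairing F (t.map (traceClassMap v))) = matrixPairing t Y := by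
    ext ⟨a, p⟩ ⟨b, q⟩
    change F p q (traceClassMap v (t a b)) = t a b (v.map (F p q))
    rw [traceClassMap_apply]
    conv_rhs => rw [traceClass_eq_sum (t a b)]
    simp [coordMatrix_apply]
  rw [← norm_reindex (Equiv.prodComm (Fin m) (Fin m)), h1]
  refine (norm_matrixPairing_le t Y).trans
    (mul_le_mul_of_nonneg_left ?_ (dualNorm_nonneg t))
  have h2 : OperatorSpace.mnorm m Y = ‖matrixPairing F v‖ := rfl
  rw [h2]
  exact (norm_matrixPairing_le F v).trans (mul_le_of_le_one_left (apply_nonneg _ _) hF)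

end TraceClassMaps

/-! ### A Goldstine theorem for maps out of `T_n ⧸ X` -/

section Approximation
variable {V : Type*} [NormedAddCommGroup V] [NormedSpace ℂ V]

/-- A functional on `M_n(V)` that annihilates all `v` inducing maps `T_n ⧸ X → V` also annihilates
the elements of `M_n(V**)` given by maps `T_n ⧸ X → V**`. -/
theorem tracePairing_eq_zero_of_annihilates {n : ℕ} (X : Submodule ℂ (TraceClass n))
    (ψ : (TraceClass n ⧸ X) →ₗ[ℂ] Bidual V) (f : Matrix (Fin n) (Fin n) (Dual V))
    (hf : ∀ v : Matrix (Fin n) (Fin n) V, (∀ t ∈ X, traceClassMap v t = 0) →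
      tracePairing n f v = 0) :
    tracePairing n ((coordMatrix n).map (ψ ∘ₗ X.mkQ)) f = 0 := by
  obtain ⟨s, hs⟩ := X.mkQ.exists_rightInverse_of_surjective X.range_mkQ
  have hs' : ∀ q, X.mkQ (s q) = q := fun q => LinearMap.congr_fun hs q
  -- The coefficients of the projection `s ∘ X.mkQ` of `T_n`, which has kernel `X`. For fixed `k`,
  -- `l` and any `v`, the matrix `c i j k l • v` therefore induces a map vanishing on `X`, and `f`
  -- kills it.
  let c : Fin n → Fin n → Fin n → Fin n → ℂ := fun i j k l =>
    s (X.mkQ (coordMatrix n i j)) (Matrix.single k l 1)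
  have hc : ∀ i j, ψ (X.mkQ (coordMatrix n i j)) =
      ∑ k, ∑ l, c i j k l • ψ (X.mkQ (coordMatrix n k l)) := fun i j => by
    conv_lhs => rw [← hs' (X.mkQ (coordMatrix n i j)),
      traceClass_eq_sum (s (X.mkQ (coordMatrix n i j)))]
    simp only [map_sum, map_smul]
    rfl
  have hzero : ∀ k l, ∑ i, ∑ j, c i j k l • f i j = 0 := fun k l => by
    ext v
    have h1 := hf (Matrix.of fun i j => c i j k l • v) fun t ht => by
      have h2 : s (X.mkQ t) = 0 := by
        rw [Submodule.mkQ_apply, (Submodule.Quotient.mk_eq_zero X).2 ht, map_zero]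
      rw [traceClass_eq_sum t] at h2
      have h3 := DFunLike.congr_fun h2 (Matrix.single k l 1)
      simp only [map_sum, map_smul, _root_.sum_apply, _root_.smul_apply, smul_eq_mul,
        _root_.zero_apply] at h3
      simp only [traceClassMap_apply, Matrix.of_apply, smul_smul, ← Finset.sum_smul]
      exact (congrArg (· • v) h3).trans (zero_smul _ _)
    simpa [tracePairing_apply] using h1
  calc tracePairing n ((coordMatrix n).map (ψ ∘ₗ X.mkQ)) f
      = ∑ i, ∑ j, ψ (X.mkQ (coordMatrix n i j)) (f i j) := rfl
    _ = ∑ i, ∑ j, ∑ k, ∑ l, c i j k l * ψ (X.mkQ (coordMatrix n k l)) (f i j) := by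
        refine Finset.sum_congr rfl fun i _ => Finset.sum_congr rfl fun j _ => ?_
        rw [hc i j]
        simp only [_root_.sum_apply, _root_.smul_apply, smul_eq_mul]
    _ = ∑ x : Fin n × Fin n, ∑ y : Fin n × Fin n,
          c x.1 x.2 y.1 y.2 * ψ (X.mkQ (coordMatrix n y.1 y.2)) (f x.1 x.2) := by
        simp only [Fintype.sum_prod_type]
    _ = ∑ y : Fin n × Fin n, ψ (X.mkQ (coordMatrix n y.1 y.2))
          (∑ i, ∑ j, c i j y.1 y.2 • f i j) := by
        rw [Finset.sum_comm]
        refine Finset.sum_congr rfl fun y _ => ?_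
        simp only [Fintype.sum_prod_type, map_sum, map_smul, smul_eq_mul]
    _ = 0 := by simp [hzero]

/-- Strict separation of a point from a convex set in a weak topology. -/
theorem exists_weakBilin_separation {E F : Type*} [AddCommGroup E] [Module ℂ E] [AddCommGroup F]
    [Module ℂ F] (B : E →ₗ[ℂ] F →ₗ[ℂ] ℂ) {K : Set E} (hK : Convex ℝ K) {u : E}
    (hu : u ∉ closure (X := WeakBilin B) K) :
    ∃ (y : F) (s : ℝ), (∀ v ∈ K, (B v y).re < s) ∧ s < (B u y).re := by
  have : ContinuousSMul ℝ (WeakBilin B) := IsScalarTower.continuousSMul (M := ℝ) ℂ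
  have hK' : Convex ℝ (closure (X := WeakBilin B) K) := Convex.closure (E := WeakBilin B) hK
  obtain ⟨L, s, hLs, hsL⟩ := RCLike.geometric_hahn_banach_closed_point (𝕜 := ℂ)
    (E := WeakBilin B) hK' isClosed_closure hu
  obtain ⟨y, rfl⟩ := LinearMap.dualEmbedding_surjective _ L
  exact ⟨y, s, fun v hv => hLs v (subset_closure (X := WeakBilin B) hv), hsL⟩

variable [OperatorSpace V]

/-- The elements of `M_n(V)` of norm at most `b` that induce maps `T_n ⧸ X → V`. -/
def annihilatorBall {n : ℕ} (V : Type*) [NormedAddCommGroup V] [NormedSpace ℂ V]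
    [OperatorSpace V] (X : Submodule ℂ (TraceClass n)) (b : ℝ) : Set (Matrix (Fin n) (Fin n) V) :=
  {v | OperatorSpace.mnorm n v ≤ b ∧ ∀ t ∈ X, traceClassMap v t = 0}

/-- A weak* version of Goldstine's theorem for maps `T_n ⧸ X → V**`. -/
theorem mem_closure_annihilatorBall {n : ℕ} (X : Submodule ℂ (TraceClass n))
    (ψ : (TraceClass n ⧸ X) →ₗ[ℂ] Bidual V) {b : ℝ} (hb : 0 < b)
    (hψ : ∀ (m : ℕ) (q : Matrix (Fin m) (Fin m) (TraceClass n ⧸ X)),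
      OperatorSpace.mnorm (V := Bidual V) m (q.map ψ) ≤ b * quotientNorm X q) :
    (coordMatrix n).map (ψ ∘ₗ X.mkQ) ∈
      closure (X := WeakBilin (tracePairing (V := Dual V) n)) (((NormedSpace.inclusionInDoubleDual ℂ V).toLinearMap.mapMatrix :
        Matrix (Fin n) (Fin n) V →ₗ[ℂ] Matrix (Fin n) (Fin n) (Bidual V)) ''
          annihilatorBall V X b) := by
  set u : Matrix (Fin n) (Fin n) (Bidual V) := (coordMatrix n).map (ψ ∘ₗ X.mkQ)
  set J : Matrix (Fin n) (Fin n) V →ₗ[ℂ] Matrix (Fin n) (Fin n) (Bidual V) :=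
    (NormedSpace.inclusionInDoubleDual ℂ V).toLinearMap.mapMatrix
  have hub : OperatorSpace.mnorm (V := Bidual V) n u ≤ b := by
    have h1 := hψ n ((coordMatrix n).map X.mkQ)
    have h2 : quotientNorm X ((coordMatrix n).map X.mkQ) ≤ 1 :=
      (quotientNorm_le X _).trans (mnorm_coordMatrix_le n)
    exact h1.trans (mul_le_of_le_one_right hb.le h2)
  by_contra hcon
  have hconv : Convex ℝ (annihilatorBall V X b) := by
    rintro v ⟨hv, hvX⟩ w ⟨hw, hwX⟩ s t hs ht hst
    refine ⟨?_, fun x hx => ?_⟩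
    · have h1 : OperatorSpace.mnorm n (s • v) = s * OperatorSpace.mnorm n v := by
        rw [← Complex.coe_smul, map_smul_eq_mul, Complex.norm_real, Real.norm_of_nonneg hs]
      have h2 : OperatorSpace.mnorm n (t • w) = t * OperatorSpace.mnorm n w := by
        rw [← Complex.coe_smul, map_smul_eq_mul, Complex.norm_real, Real.norm_of_nonneg ht]
      refine (map_add_le_add _ _ _).trans ?_
      rw [h1, h2]
      calc _ ≤ s * b + t * b := by gcongr
        _ = b := by rw [← add_mul, hst, one_mul]
    · have h1 := hvX x hx
      have h2 := hwX x hx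
      rw [traceClassMap_apply] at h1 h2 ⊢
      simp only [Matrix.add_apply, Matrix.smul_apply, smul_add, Finset.sum_add_distrib,
        smul_comm _ s, smul_comm _ t, ← Finset.smul_sum, h1, h2, smul_zero, add_zero]
  obtain ⟨D, s, hLs, hsu⟩ := exists_weakBilin_separation (tracePairing (V := Dual V) n)
    (hconv.linear_image (J.restrictScalars ℝ)) hcon
  have hsv : ∀ v ∈ annihilatorBall V X b, (tracePairing n D v).re < s := fun v hv =>
    hLs _ ⟨v, hv, rfl⟩
  have hs : 0 < s := by
    have := hsv 0 ⟨by simpa using hb.le, by simp [traceClassMap_apply]⟩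
    simpa using this
  let Z : Submodule ℂ (Matrix (Fin n) (Fin n) V) :=
    { carrier := {v | ∀ t ∈ X, traceClassMap v t = 0}
      add_mem' := fun {v w} hv hw t ht => by
        have h1 := hv t ht
        have h2 := hw t ht
        rw [traceClassMap_apply] at h1 h2 ⊢
        simp only [Matrix.add_apply, smul_add, Finset.sum_add_distrib, h1, h2, add_zero]
      zero_mem' := fun t _ => by simp [traceClassMap_apply]
      smul_mem' := fun c v hv t ht => by
        have h1 := hv t ht
        rw [traceClassMap_apply] at h1 ⊢
        simp only [Matrix.smul_apply, smul_comm _ c, ← Finset.smul_sum, h1, smul_zero] }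
  -- `Re D < s` on the ball of radius `b` in `Z` bounds `|D|` there by rotation invariance, so `(b /
  -- s) D` is contractive on `Z`.
  have hZ : ∀ v ∈ Z, ‖tracePairing n (((b / s : ℝ) : ℂ) • D) v‖ ≤ OperatorSpace.mnorm n v := by
    intro v hv
    set z := tracePairing n D v with hz
    have h1 : tracePairing n (((b / s : ℝ) : ℂ) • D) v = ((b / s : ℝ) : ℂ) * z := by simp [hz]
    rw [h1, norm_mul, Complex.norm_real, Real.norm_of_nonneg (by positivity), div_mul_eq_mul_div,
      div_le_iff₀ hs]
    rcases eq_or_lt_of_le (apply_nonneg (OperatorSpace.mnorm (V := V) n) v) with h | h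
    · have h0 := OperatorSpace.mnorm_eq_zero v h.symm
      simp [hz, h0]
    rcases eq_or_ne z 0 with h0 | h0
    · rw [h0, norm_zero, mul_zero]
      positivity
    have hz0 : 0 < ‖z‖ := norm_pos_iff.2 h0
    -- With this `r`, the multiple `(r z̄) v` has norm exactly `b`, and `D` takes the real value `r
    -- |z|²` on it.
    set r : ℝ := b / (OperatorSpace.mnorm n v * ‖z‖) with hr
    have hr0 : 0 < r := by positivity
    have h2 := hsv (((r : ℂ) * star z) • v) ⟨by
      rw [map_smul_eq_mul, norm_mul, Complex.norm_real, Real.norm_of_nonneg hr0.le, norm_star, hr]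
      refine le_of_eq ?_
      field_simp, Z.smul_mem _ hv⟩
    rw [map_smul, ← hz, smul_eq_mul, mul_assoc, mul_comm (star z), RCLike.star_def,
      Complex.mul_conj, ← Complex.ofReal_mul, Complex.ofReal_re, Complex.normSq_eq_norm_sq, hr,
      div_mul_eq_mul_div, div_lt_iff₀ (by positivity)] at h2
    nlinarith
  -- A contractive extension `f` of `(b / s) D` from `Z` differs from it by an annihilator of `Z`,
  -- on which `u` vanishes. Thus `Re ⟨u, f⟩ = (b / s) Re ⟨u, D⟩ > b`, against `‖u‖ ≤ b`.
  obtain ⟨H, hHZ, hH⟩ := Module.Dual.exists_extension_of_le_seminorm Z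
    (tracePairing n (((b / s : ℝ) : ℂ) • D) ∘ₗ Z.subtype) (p := OperatorSpace.mnorm n)
    fun v => hZ v v.2
  obtain ⟨f, hf⟩ := exists_tracePairing_eq H hH
  have h1 := tracePairing_eq_zero_of_annihilates X ψ (f - ((b / s : ℝ) : ℂ) • D) fun v hv => by
    have h2 := hHZ ⟨v, hv⟩
    rw [map_sub, LinearMap.sub_apply, hf, sub_eq_zero]
    exact h2
  rw [map_sub, sub_eq_zero, map_smul, smul_eq_mul] at h1
  have h2 := norm_tracePairing_bidual_le u f fun v => by rw [hf]; exact hH v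
  have h3 : (tracePairing n u f).re = b / s * (tracePairing (V := Dual V) n u D).re := by
    rw [h1, Complex.re_ofReal_mul]
  have h4 : b < (tracePairing n u f).re := by
    rw [h3, div_mul_eq_mul_div, lt_div_iff₀ hs]
    exact mul_lt_mul_of_pos_left hsu hb
  exact absurd (((Complex.re_le_norm _).trans h2).trans hub) (not_le.2 h4)

/-- Maps `T_n ⧸ X → V**` are point-weak* limits of maps `T_n ⧸ X → V` with the same completely
bounded norm. -/
theorem mem_closure_quotient_maps {n : ℕ} (X : Submodule ℂ (TraceClass n))
    (ψ : (TraceClass n ⧸ X) →ₗ[ℂ] Bidual V) {b : ℝ} (hb : 0 < b)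
    (hψ : ∀ (m : ℕ) (q : Matrix (Fin m) (Fin m) (TraceClass n ⧸ X)),
      OperatorSpace.mnorm (V := Bidual V) m (q.map ψ) ≤ b * quotientNorm X q) :
    (fun p : (TraceClass n ⧸ X) × Dual V => ψ p.1 p.2) ∈
      closure ((fun (Ψ : (TraceClass n ⧸ X) →ₗ[ℂ] V) (p : (TraceClass n ⧸ X) × Dual V) =>
        p.2 (Ψ p.1)) '' {Ψ | ∀ (m : ℕ) (q : Matrix (Fin m) (Fin m) (TraceClass n ⧸ X)),
          OperatorSpace.mnorm m (q.map Ψ) ≤ b * quotientNorm X q}) := by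
  obtain ⟨s, hs⟩ := X.mkQ.exists_rightInverse_of_surjective X.range_mkQ
  have hs' : ∀ q, X.mkQ (s q) = q := fun q => LinearMap.congr_fun hs q
  -- Each value `f(Ψ(q))` is the pairing of the matrix of `Ψ` with one fixed element of `M_n(V*)`,
  -- so passing from matrices to maps is continuous for the weak topologies.
  let M : WeakBilin (tracePairing (V := Dual V) n) → (TraceClass n ⧸ X) × Dual V → ℂ := fun w p =>
    tracePairing n w (Matrix.of fun i j => s p.1 (Matrix.single i j 1) • p.2)
  have hM : Continuous M := continuous_pi fun p => WeakBilin.eval_continuous _ _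
  have h := map_mem_closure hM (mem_closure_annihilatorBall X ψ hb hψ)
    (t := (fun (Ψ : (TraceClass n ⧸ X) →ₗ[ℂ] V) (p : (TraceClass n ⧸ X) × Dual V) =>
        p.2 (Ψ p.1)) '' {Ψ | ∀ (m : ℕ) (q : Matrix (Fin m) (Fin m) (TraceClass n ⧸ X)),
          OperatorSpace.mnorm m (q.map Ψ) ≤ b * quotientNorm X q}) (by
    rintro _ ⟨v, ⟨hv, hvX⟩, rfl⟩
    refine ⟨traceClassMap v ∘ₗ s, fun m q => ?_, ?_⟩
    · have h1 : ∀ t : Matrix (Fin m) (Fin m) (TraceClass n), t.map X.mkQ = q →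
          OperatorSpace.mnorm m (q.map (traceClassMap v ∘ₗ s)) ≤ b * OperatorSpace.mnorm m t := by
        rintro t rfl
        have h2 : (t.map X.mkQ).map (traceClassMap v ∘ₗ s) = t.map (traceClassMap v) := by
          ext i j
          have h3 : s (X.mkQ (t i j)) - t i j ∈ X := by
            rw [← Submodule.Quotient.mk_eq_zero, ← Submodule.mkQ_apply, map_sub, hs', sub_self]
          have h4 := hvX _ h3
          rw [map_sub, sub_eq_zero] at h4
          exact h4
        rw [h2]
        exact (mnorm_map_traceClassMap_le v t).trans
          (mul_le_mul_of_nonneg_right hv (apply_nonneg _ _))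
      rw [← div_le_iff₀' hb]
      exact le_quotientNorm X q fun t ht => (div_le_iff₀' hb).2 (h1 t ht)
    · funext p
      change p.2 (traceClassMap v (s p.1)) =
        ∑ i, ∑ j, (s p.1 (Matrix.single i j 1) • p.2) (v i j)
      simp [traceClassMap_apply])
  convert h using 1
  funext p
  change ψ p.1 p.2 = ∑ i, ∑ j, ψ (X.mkQ (coordMatrix n i j)) (s p.1 (Matrix.single i j 1) • p.2)
  conv_lhs => rw [← hs' p.1, traceClass_eq_sum (s p.1)]
  simp only [map_sum, map_smul, _root_.sum_apply, _root_.smul_apply]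

end Approximation

/-! ### Completely bounded norms and distances -/

section CbNorm
variable {V W : Type*} [NormedAddCommGroup V] [NormedSpace ℂ V] [OperatorSpace V]
  [NormedAddCommGroup W] [NormedSpace ℂ W] [OperatorSpace W]

theorem cbNorm_le_iff (φ : V →ₗ[ℂ] W) (C : ℝ≥0) :
    cbNorm φ ≤ C ↔ ∀ (n : ℕ) (x : Matrix (Fin n) (Fin n) V),
      OperatorSpace.mnorm n (x.map φ) ≤ C * OperatorSpace.mnorm n x := by
  simp only [cbNorm, iSup_le_iff]
  refine ⟨fun h n x => ?_, fun h n x hx => ?_⟩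
  · rcases eq_or_lt_of_le (apply_nonneg (OperatorSpace.mnorm (V := V) n) x) with h0 | h0
    · have hx := OperatorSpace.mnorm_eq_zero x h0.symm
      have h1 : (0 : Matrix (Fin n) (Fin n) V).map φ = 0 := by ext; simp
      rw [hx, h1, map_zero, map_zero, mul_zero]
    · have h1 := h n ((((OperatorSpace.mnorm n x)⁻¹ : ℝ) : ℂ) • x) (by
        rw [map_smul_eq_mul, Complex.norm_real, Real.norm_of_nonneg (by positivity),
          inv_mul_cancel₀ h0.ne'])
      have h2 : ((((OperatorSpace.mnorm n x)⁻¹ : ℝ) : ℂ) • x).map φ =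
          (((OperatorSpace.mnorm n x)⁻¹ : ℝ) : ℂ) • x.map φ := by ext; simp
      rw [h2, map_smul_eq_mul, Complex.norm_real, Real.norm_of_nonneg (by positivity),
        ENNReal.ofReal_le_iff_le_toReal ENNReal.coe_ne_top, ENNReal.coe_toReal,
        inv_mul_le_iff₀ h0, mul_comm] at h1
      exact h1
  · rw [ENNReal.ofReal_le_iff_le_toReal ENNReal.coe_ne_top, ENNReal.coe_toReal]
    exact (h n x).trans (mul_le_of_le_one_right C.2 hx)

/-- The strict inequality leaves room to enlarge the bound for the inverse to a positive `b`, as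
`mem_closure_quotient_maps` requires even when the spaces are zero. -/
theorem exists_factors_of_dcb_lt {C : ℝ≥0} (h : dcb V W < C) :
    ∃ (θ : V ≃ₗ[ℂ] W) (a b : ℝ≥0), 0 < b ∧ a * b ≤ C ∧ cbNorm θ.toLinearMap ≤ a ∧
      cbNorm θ.symm.toLinearMap ≤ b := by
  simp only [dcb, iInf_lt_iff] at h
  obtain ⟨θ, h1, h2, h3⟩ := h
  lift cbNorm θ.toLinearMap to ℝ≥0 using h1.ne with a ha
  lift cbNorm θ.symm.toLinearMap to ℝ≥0 using h2.ne with b hb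
  have h4 : a * b < C := by exact_mod_cast h3
  have ht : Tendsto (fun b' => a * b') (𝓝[>] b) (𝓝 (a * b)) :=
    (Continuous.tendsto (by fun_prop) b).mono_left nhdsWithin_le_nhds
  obtain ⟨b', h5, h6⟩ := ((ht.eventually_lt_const h4).and self_mem_nhdsWithin).exists
  exact ⟨θ, a, b', zero_le.trans_lt h6, h5.le, ha.ge, hb.ge.trans (by exact_mod_cast le_of_lt h6)⟩

end CbNorm

/-! ### Transfer to `W` and removal of `ε` -/

section LocalReflexivity
variable {V : Type*} [NormedAddCommGroup V] [NormedSpace ℂ V] [OperatorSpace V]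
  {W : Type*} [NormedAddCommGroup W] [NormedSpace ℂ W] [OperatorSpace W]

theorem mem_closure_of_dcb_lt (φ : W →ₗ[ℂ] Bidual V) (hφ : cbNorm (W := Bidual V) φ ≤ 1)
    (E : Submodule ℂ (Bidual V)) (hE : LinearMap.range φ ≤ E) {C : ℝ≥0} {n : ℕ}
    (X : Submodule ℂ (TraceClass n)) (h : dcb E (TraceClass n ⧸ X) < C) :
    (fun p : W × Dual V => φ p.1 p.2) ∈
      closure ((fun (Φ : W →ₗ[ℂ] V) (p : W × Dual V) => p.2 (Φ p.1)) '' {Φ | cbNorm Φ ≤ C}) := by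
  obtain ⟨θ, a, b, hb, hab, hθa, hθb⟩ := exists_factors_of_dcb_lt h
  rw [cbNorm_le_iff] at hθa hθb
  have hφ' := (cbNorm_le_iff (W := Bidual V) φ 1).1 (by simpa using hφ)
  let φE : W →ₗ[ℂ] E := φ.codRestrict E fun x => hE ⟨x, rfl⟩
  have h1 := mem_closure_quotient_maps X (E.subtype ∘ₗ θ.symm.toLinearMap) (b := b) hb
    fun m q => hθb m q
  -- Precomposition with `θ ∘ φE`, of cb norm at most `a`, is continuous for pointwise convergence
  -- and takes bound `b` to `a * b ≤ C`.
  let M : ((TraceClass n ⧸ X) × Dual V → ℂ) → W × Dual V → ℂ := fun g p => g (θ (φE p.1), p.2)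
  have hM : Continuous M := continuous_pi fun p => continuous_apply _
  have h2 := map_mem_closure hM h1 (t := (fun (Φ : W →ₗ[ℂ] V) (p : W × Dual V) =>
    p.2 (Φ p.1)) '' {Φ | cbNorm Φ ≤ C}) (by
    rintro _ ⟨Ψ, hΨ, rfl⟩
    refine ⟨Ψ ∘ₗ θ.toLinearMap ∘ₗ φE, (cbNorm_le_iff _ _).2 fun m x => ?_, rfl⟩
    have h3 : OperatorSpace.mnorm (self := instSubspace E) m (x.map φE) ≤
        1 * OperatorSpace.mnorm m x := hφ' m x
    have h4 := hθa m (x.map φE)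
    have h5 := hΨ m ((x.map φE).map θ.toLinearMap)
    have h6 : (a : ℝ) * b ≤ C := by exact_mod_cast hab
    calc OperatorSpace.mnorm m (x.map (Ψ ∘ₗ θ.toLinearMap ∘ₗ φE))
        ≤ b * (a * (1 * OperatorSpace.mnorm m x)) := by
          refine h5.trans (mul_le_mul_of_nonneg_left (h4.trans ?_) b.2)
          exact mul_le_mul_of_nonneg_left h3 a.2
      _ = a * b * OperatorSpace.mnorm m x := by ring
      _ ≤ _ := mul_le_mul_of_nonneg_right h6 (apply_nonneg _ _))
  convert h2 using 1
  funext p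
  simp [M, φE]

theorem cbNorm_smul_le (φ : W →ₗ[ℂ] V) {C : ℝ≥0} (h : cbNorm φ ≤ C) (r : ℝ≥0) :
    cbNorm (((r : ℝ) : ℂ) • φ) ≤ (r * C : ℝ≥0) := by
  rw [cbNorm_le_iff] at h ⊢
  intro m x
  have h1 : x.map (((r : ℝ) : ℂ) • φ) = ((r : ℝ) : ℂ) • x.map φ := rfl
  rw [h1, map_smul_eq_mul, Complex.norm_real, Real.norm_of_nonneg (NNReal.coe_nonneg r), NNReal.coe_mul, mul_assoc]
  exact mul_le_mul_of_nonneg_left (h m x) r.2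

theorem norm_apply_le_of_cbNorm_le (φ : W →ₗ[ℂ] V) {C : ℝ≥0} (h : cbNorm φ ≤ C) (x : W) :
    ‖φ x‖ ≤ C * ‖x‖ := by
  have h1 := (cbNorm_le_iff φ C).1 h 1 (Matrix.of fun _ _ => x)
  rwa [OperatorSpace.mnorm_one, OperatorSpace.mnorm_one] at h1

/-- For `c ≠ 0`, rescaling by `c / (c + ε)` and letting `ε → 0` stays in the closed set. For `c = 0`
that factor is zero, but the bounds force `φ = 0`, and the zero map serves. -/
theorem mem_closure_of_forall_add (φ : W →ₗ[ℂ] Bidual V) (c : ℝ≥0)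
    (h : ∀ ε : ℝ≥0, 0 < ε → (fun p : W × Dual V => φ p.1 p.2) ∈
      closure ((fun (Φ : W →ₗ[ℂ] V) (p : W × Dual V) => p.2 (Φ p.1)) ''
        {Φ | cbNorm Φ ≤ (c + ε : ℝ≥0)})) :
    (fun p : W × Dual V => φ p.1 p.2) ∈
      closure ((fun (Φ : W →ₗ[ℂ] V) (p : W × Dual V) => p.2 (Φ p.1)) '' {Φ | cbNorm Φ ≤ c}) := by
  rcases eq_or_ne c 0 with rfl | hc
  · have h1 : ∀ (x : W) (f : Dual V), φ x f = 0 := fun x f => by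
      have h2 : ∀ ε : ℝ≥0, 0 < ε → ‖φ x f‖ ≤ ε * (‖f‖ * ‖x‖) := fun ε hε => by
        have h3 := map_mem_closure (continuous_norm.comp (continuous_apply (x, f))) (h ε hε)
          (t := Set.Iic (ε * (‖f‖ * ‖x‖))) (by
          rintro _ ⟨Φ, hΦ, rfl⟩
          have h4 := norm_apply_le_of_cbNorm_le Φ hΦ x
          rw [zero_add] at h4
          calc ‖f (Φ x)‖ ≤ ‖f‖ * (ε * ‖x‖) :=
                (f.le_opNorm _).trans (mul_le_mul_of_nonneg_left h4 (norm_nonneg _))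
            _ = _ := by ring)
        rwa [closure_Iic] at h3
      have ht : Tendsto (fun ε : ℝ≥0 => (ε : ℝ) * (‖f‖ * ‖x‖)) (𝓝[>] 0)
          (𝓝 (((0 : ℝ≥0) : ℝ) * (‖f‖ * ‖x‖))) :=
        (Continuous.tendsto (by fun_prop) 0).mono_left nhdsWithin_le_nhds
      rw [NNReal.coe_zero, zero_mul] at ht
      exact norm_le_zero_iff.1 (ge_of_tendsto ht (eventually_mem_nhdsWithin.mono fun ε hε => h2 ε hε))
    refine subset_closure ⟨0, (cbNorm_le_iff _ _).2 fun m x => ?_, ?_⟩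
    · have h2 : x.map (0 : W →ₗ[ℂ] V) = 0 := rfl
      rw [h2, map_zero]
      simp
    · funext p
      simp [h1]
  · have h1 : ∀ ε : ℝ≥0, 0 < ε →
        (fun p : W × Dual V => ((c / (c + ε) : ℝ≥0) : ℂ) * φ p.1 p.2) ∈
        closure ((fun (Φ : W →ₗ[ℂ] V) (p : W × Dual V) => p.2 (Φ p.1)) '' {Φ | cbNorm Φ ≤ c}) := by
      intro ε hε
      have hM : Continuous fun (g : W × Dual V → ℂ) (p : W × Dual V) =>
          ((c / (c + ε) : ℝ≥0) : ℂ) * g p := by fun_prop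
      refine map_mem_closure hM (h ε hε) ?_
      rintro _ ⟨Φ, hΦ, rfl⟩
      refine ⟨(((c / (c + ε) : ℝ≥0) : ℝ) : ℂ) • Φ, ?_, ?_⟩
      · refine (cbNorm_smul_le Φ hΦ _).trans ?_
        rw [div_mul_cancel₀ _ (by positivity)]
      · funext p
        simp
    have ht : Tendsto (fun (ε : ℝ≥0) (p : W × Dual V) => ((c / (c + ε) : ℝ≥0) : ℂ) * φ p.1 p.2)
        (𝓝[>] 0) (𝓝 fun p => φ p.1 p.2) := by
      refine tendsto_pi_nhds.2 fun p => ?_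
      have h2 : Tendsto (fun ε : ℝ≥0 => c / (c + ε)) (𝓝[>] 0) (𝓝 (c / (c + 0))) := by
        refine Tendsto.mono_left ?_ nhdsWithin_le_nhds
        exact tendsto_const_nhds.div (tendsto_const_nhds.add tendsto_id) (by simpa using hc)
      rw [add_zero, div_self hc] at h2
      have h3 : Continuous fun r : ℝ≥0 => (r : ℂ) * φ p.1 p.2 :=
        (Complex.continuous_ofReal.comp NNReal.continuous_coe).mul continuous_const
      have h4 := (h3.tendsto 1).comp h2
      rw [NNReal.coe_one, Complex.ofReal_one, one_mul] at h4
      exact h4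
    exact isClosed_closure.mem_of_tendsto ht (eventually_mem_nhdsWithin.mono fun ε hε => h1 ε hε)

end LocalReflexivity

/-- If `V**` is `c`-subcoexact, then `V` is locally reflexive with constant `c`. -/
theorem IsSubcoexact.isLocallyReflexiveWith {V : Type u} [NormedAddCommGroup V] [NormedSpace ℂ V]
    [OperatorSpace V] {c : ℝ≥0} (h : IsSubcoexact c (Bidual V)) :
    IsLocallyReflexiveWith.{u, w} c V := by
  intro W _ _ _ _ φ hφ
  obtain ⟨E, hE, -, hEc⟩ := h (LinearMap.range φ) inferInstance
  let ev : (W →ₗ[ℂ] V) → W × Dual V → ℂ := fun Φ p => p.2 (Φ p.1)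
  have hcl : (fun p : W × Dual V => φ p.1 p.2) ∈ closure (ev '' {Φ | cbNorm Φ ≤ c}) := by
    refine mem_closure_of_forall_add φ c fun ε hε => ?_
    obtain ⟨n, X, hX⟩ := hEc ε hε
    exact mem_closure_of_dcb_lt φ hφ E hE X (by rwa [ENNReal.coe_add])
  -- A point in the closure of the range of `ev` is its limit along the pulled-back neighbourhood
  -- filter. The admissible maps themselves thus index the net, and coordinatewise convergence in `W
  -- × Dual V → ℂ` is point-weak* convergence.
  rw [Set.image_eq_range, mem_closure_iff_frequently,
    ← comap_neBot_iff_frequently] at hcl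
  exact ⟨{Φ : W →ₗ[ℂ] V // cbNorm Φ ≤ c}, _, Subtype.val, hcl, fun Φ => Φ.2,
    fun x f => tendsto_pi_nhds.1 (tendsto_comap (f := fun Φ : {Φ : W →ₗ[ℂ] V // cbNorm Φ ≤ c} => ev Φ)) (x, f)⟩

end OpSpace

theorem mainTheorem8 (V : Type u) [NormedAddCommGroup V] [NormedSpace ℂ V]
    [OpSpace.OperatorSpace V] :
    (OpSpace.IsSubcoexact 1 (OpSpace.Bidual V) → OpSpace.IsLocallyReflexive.{u, w} V) ∧
      ∀ c : ℝ≥0, OpSpace.IsSubcoexact c (OpSpace.Bidual V) →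
        OpSpace.IsLocallyReflexiveWith.{u, w} c V := by
  exact ⟨fun h => h.isLocallyReflexiveWith, fun c h => h.isLocallyReflexiveWith⟩
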